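/- For $m\in\mathbb N$ and $t>0$ equip $\mathbb C^m$ with the matrix norms $$\|x\|_{M_k(K(t))}=\inf_{x=x_1+x_2+x_3}\big\{\|x_1\|_{M_k(\ell_\infty^m)}+\sqrt t\,\|x_2\|_{M_k(R^m+C^m)}+t\,\|x_3\|_{M_k(\ell_1^m)}\big\},\qquad x\in M_k(\mathbb C^m),\ k\ge 1,$$ where, for $x=\sum_j A_j\otimes e_j\in M_k\otimes\mathbb C^m$: $\|x\|_{M_k(\ell_\infty^m)}=\max_j\|A_j\|$; $\|x\|_{M_k(R^m)}=\|\sum_j A_jA_j^*\|^{1/2}$; $\|x\|_{M_k(C^m)}=\|\sum_j A_j^*A_j\|^{1/2}$; $\|x\|_{M_k(R^m+C^m)}=\inf_{x=y+z}\big(\|y\|_{M_k(R^m)}+\|z\|_{M_k(C^m)}\big)$; and $\|x\|_{M_k(\ell_1^m)}$ is the completely bounded norm of the map $\ell_\infty^m\to M_k$, $e_j\mapsto A_j$. For $q>2$ let $X_t^q=t^{-1/q}K(t;\ell_\infty^m,R^m+C^m,\ell_1^m)$, that is, $\mathbb C^m$ with the matrix norms $t^{-1/q}\|\cdot\|_{M_k(K(t))}$.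 For $a\in X\otimes X$ let $\|a\|_{\epsilon}=\sup|(\varphi\otimes\psi)(a)|$ over $\varphi,\psi$ in the unit ball of the dual of the Banach space $X$, and $\|a\|_{\min}=\sup\|(u\otimes v)(a)\|$ over all complete contractions $u:X\to M_k$, $v:X\to M_l$, $k,l\ge 1$. Theorem. For every $2<q<\infty$ there are constants $D(q),\kappa(q)>0$, depending only on $q$, such that for all integers $n\ge 1$ and $m$ with $n^{q/2}\le m\le 2n^{q/2}$ the following holds with $t=n/m$. There is a tensor $a\in X_t^q\otimes X_t^q$ of rank $n$ with $$\|a\|_{\epsilon}\le D(q)\qquad\text{and}\qquad \|a\|_{\min}\ge n^{\frac12-\frac2q}.$$ Moreover, if $G=\sum_{i=1}^n\sum_{j=1}^m g_{ij}\,e_i\otimes e_j:\ell_2^n\to\mathbb C^m$ with independent standard real Gaussian variables $g_{ij}$, then with positive probability the image of the identity $$a=\kappa(q)\,m^{-2/q}\,(G\otimes G)\Big(\sum_{i=1}^n e_i\otimes e_i\Big)=\kappa(q)\,m^{-2/q}\sum_{i=1}^n Ge_i\otimes Ge_i$$ has these three properties. -/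

import Mathlib

open MeasureTheory ProbabilityTheory
open scoped Kronecker Matrix

namespace OpSpace

noncomputable section

/-- The operator norm of a square complex matrix acting on the Hilbert space `ℓ₂`. -/
def opNorm {ι : Type*} [Fintype ι] [DecidableEq ι] (A : Matrix ι ι ℂ) : ℝ :=
  ‖Matrix.toEuclideanCLM (n := ι) (𝕜 := ℂ) A‖

/-- An element `∑ j, x j ⊗ e_j` of `M_k(ℂ^m) = M_k ⊗ ℂ^m`, given by its `m` coefficients. -/
abbrev MatTuple (m k : ℕ) : Type := Fin m → Matrix (Fin k) (Fin k) ℂ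

/-- A sequence of candidate norms on the spaces `M_k(ℂ^m)`, `k = 0, 1, 2, …`. -/
abbrev MatNorms (m : ℕ) : Type := ∀ k : ℕ, MatTuple m k → ℝ

/-- `M_k(ℓ_∞^m)`: the maximum of the norms of the coefficients. -/
def linfty (m : ℕ) : MatNorms m := fun _ x => ⨆ j, opNorm (x j)

/-- `M_k(R^m)`: `‖∑ x_j x_j^*‖^{1/2}`. -/
def row (m : ℕ) : MatNorms m := fun _ x => Real.sqrt (opNorm (∑ j, x j * (x j)ᴴ))

/-- `M_k(C^m)`: `‖∑ x_j^* x_j‖^{1/2}`. -/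
def col (m : ℕ) : MatNorms m := fun _ x => Real.sqrt (opNorm (∑ j, (x j)ᴴ * x j))

/-- `M_k(R^m + C^m)`: the infimum over all decompositions `x = y + z`. -/
def rowAddCol (m : ℕ) : MatNorms m := fun k x =>
  sInf {r : ℝ | ∃ y z : MatTuple m k, y + z = x ∧ r = row m k y + col m k z}

/-- The map `u_k = id ⊗ u : M_k(ℂ^m) → M_k(M_l) = M_{kl}` induced by the linear map
`u : ℂ^m → M_l` with `u e_j = U j`. -/
def amplify {m l : ℕ} (U : MatTuple m l) {k : ℕ} (x : MatTuple m k) :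
    Matrix (Fin k × Fin l) (Fin k × Fin l) ℂ :=
  ∑ j, x j ⊗ₖ U j

/-- The linear map `e_j ↦ U j` from `ℂ^m`, with the matrix norms `N`, to `M_l` is completely
contractive. -/
def IsCompleteContraction {m l : ℕ} (N : MatNorms m) (U : MatTuple m l) : Prop :=
  ∀ (k : ℕ) (x : MatTuple m k), opNorm (amplify U x) ≤ N k x

/-- `M_k(ℓ_1^m) = CB(ℓ_∞^m, M_k)`, the operator space dual of `ℓ_∞^m`: the norm of `x` is the
completely bounded norm of the map `ℓ_∞^m → M_k`, `e_j ↦ x j`. -/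
def lone (m : ℕ) : MatNorms m := fun _ x =>
  sSup {r : ℝ | ∃ (l : ℕ) (y : MatTuple m l), linfty m l y ≤ 1 ∧ r = opNorm (amplify x y)}

/-- `K(t; ℓ_∞^m, R^m + C^m, ℓ_1^m)`. -/
def kSpace (t : ℝ) (m : ℕ) : MatNorms m := fun k x =>
  sInf {r : ℝ | ∃ x₁ x₂ x₃ : MatTuple m k, x₁ + x₂ + x₃ = x ∧
    r = linfty m k x₁ + Real.sqrt t * rowAddCol m k x₂ + t * lone m k x₃}

/-- `X_t^q = t^{-1/q} K(t; ℓ_∞^m, R^m + C^m, ℓ_1^m)`. -/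
def xSpace (q t : ℝ) (m : ℕ) : MatNorms m := fun k x => t ^ (-1 / q) * kSpace t m k x

/-- The norm of the underlying Banach space, `M_1(ℂ^m) = ℂ^m`. -/
def baseNorm {m : ℕ} (N : MatNorms m) (x : Fin m → ℂ) : ℝ :=
  N 1 fun j => Matrix.of fun _ _ => x j

/-- The functional `x ↦ ∑ j, φ j * x j` lies in the unit ball of the dual Banach space. -/
def IsContractiveFunctional {m : ℕ} (N : MatNorms m) (φ : Fin m → ℂ) : Prop :=
  ∀ x : Fin m → ℂ, ‖∑ j, φ j * x j‖ ≤ baseNorm N x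

/-- The injective norm of `∑ a i j (e_i ⊗ e_j) ∈ X ⊗_ε X`. -/
def epsNorm {m : ℕ} (N : MatNorms m) (a : Matrix (Fin m) (Fin m) ℂ) : ℝ :=
  sSup {r : ℝ | ∃ φ ψ : Fin m → ℂ, IsContractiveFunctional N φ ∧ IsContractiveFunctional N ψ ∧
    r = ‖∑ i, ∑ j, a i j * (φ i * ψ j)‖}

/-- The minimal norm of `∑ a i j (e_i ⊗ e_j) ∈ X ⊗_min X`: the supremum of
`‖(u ⊗ v)(a)‖` over all complete contractions `u : X → M_k`, `v : X → M_l`. -/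
def minNorm {m : ℕ} (N : MatNorms m) (a : Matrix (Fin m) (Fin m) ℂ) : ℝ :=
  sSup {r : ℝ | ∃ (k l : ℕ) (U : MatTuple m k) (V : MatTuple m l),
    IsCompleteContraction N U ∧ IsCompleteContraction N V ∧
    r = opNorm (∑ i, ∑ j, a i j • (U i ⊗ₖ V j))}

/-- The law of an `n × m` matrix of independent standard real Gaussian variables. -/
def gaussianMatrix (n m : ℕ) : Measure (Fin n × Fin m → ℝ) :=
  Measure.pi fun _ => gaussianReal 0 1

/-- The image `∑ i, G e_i ⊗ G e_i` of the identity `∑ i, e_i ⊗ e_i ∈ ℓ_2^n ⊗ ℓ_2^n` under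
`G ⊗ G`, where `G e_i = ∑ j, g (i, j) e_j ∈ ℂ^m`. -/
def imageOfIdentity {n m : ℕ} (g : Fin n × Fin m → ℝ) : Matrix (Fin m) (Fin m) ℂ :=
  Matrix.of fun j k => ∑ i, (g (i, j) : ℂ) * (g (i, k) : ℂ)

/-- `a ∈ X_t^q ⊗ X_t^q`, with `t = n / m`, has rank `n`, injective norm at most `D`, and minimal
norm at least `n^{1/2 - 2/q}`. -/
def Separates (q D : ℝ) (n m : ℕ) (a : Matrix (Fin m) (Fin m) ℂ) : Prop :=
  a.rank = n ∧
  epsNorm (xSpace q ((n : ℝ) / m) m) a ≤ D ∧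
  (n : ℝ) ^ (1 / 2 - 2 / q) ≤ minNorm (xSpace q ((n : ℝ) / m) m) a

end

end OpSpace

/-!
Write `G` for the Gaussian `n × m` matrix, so that `a = c Gᵀ G`.

Injective norm: by Cauchy–Schwarz only `∑ i, |(G φ)_i|²` for contractive functionals `φ` matters,
hence only the norm in `X` of `ξ G` for `ξ` in a `1/2`-net of the unit sphere, of cardinality at
most `5 ^ n`. The Gaussian vector `ξ G` is split by soft thresholding at level `n ^ (1 / q)`: the
truncated part has `ℓ_∞` norm at most `n ^ (1 / q)`, and since `m exp (-n ^ (2 / q) / 4)` is bounded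
by a constant depending only on `q`, the excess has `ℓ_2` norm `O(√n)` up to a probability that
beats the `5 ^ n` points of the net. The two parts are measured in `ℓ_∞^m` and `R^m + C^m`.

Minimal norm: `‖G‖ = O(√m)` and the columns of `G` have length `O(√n)`, which makes
`e_j ↦ G e_j ∈ C^n`, suitably normalised, completely contractive on `X`. Applied to both factors it
sends `a` to a column in `M_n ⊗ M_n` whose `ℓ_2` norm is at least `n^{-1/2} tr ((G Gᵀ)²)`, hence at
least `n^{-3/2} (tr G Gᵀ)²`, while `tr G Gᵀ` has order `n m`.

These conditions define a nonempty open set of matrices, which meets the dense open set of matrices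
of rank `n`; a Gaussian measure charges every nonempty open set.
-/

namespace OpSpace

open scoped ENNReal Matrix.Norms.L2Operator

section Nets

open Metric Module

theorem packingNumber_le_five_pow_finrank {E : Type*} [NormedAddCommGroup E] [NormedSpace ℝ E]
    [FiniteDimensional ℝ E] {A : Set E} (hA : A ⊆ closedBall 0 1) :
    packingNumber (1 / 2) A ≤ 5 ^ finrank ℝ E := by
  refine iSup₂_le fun C hCA => iSup_le fun hC => ?_
  by_contra! hlt
  obtain ⟨T, hTC, hT⟩ := Set.exists_subset_encard_eq (Order.add_one_le_of_lt hlt)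
  lift T to Finset E using Set.finite_of_encard_le_coe (k := 5 ^ finrank ℝ E + 1) (by simp [hT])
  classical
  have hcard := Besicovitch.card_le_of_separated (T.image fun x => (2 : ℝ) • x) (fun c hc => ?_)
    fun c hc d hd hcd => ?_
  · rw [Finset.card_image_of_injective _ (smul_right_injective _ two_ne_zero)] at hcard
    rw [Set.encard_coe_eq_coe_finsetCard] at hT
    have : T.card = 5 ^ finrank ℝ E + 1 := by exact_mod_cast hT
    omega
  · obtain ⟨x, hx, rfl⟩ := Finset.mem_image.1 hc
    have : ‖x‖ ≤ 1 := mem_closedBall_zero_iff.1 (hA (hCA (hTC hx)))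
    rw [norm_smul, Real.norm_two]
    linarith
  · obtain ⟨x, hx, rfl⟩ := Finset.mem_image.1 hc
    obtain ⟨y, hy, rfl⟩ := Finset.mem_image.1 hd
    have hsep : (1 / 2 : ℝ) < ‖x - y‖ := by
      have : ((1 / 2 : NNReal) : ℝ≥0∞) < edist x y := hC (hTC hx) (hTC hy) fun h => hcd (by rw [h])
      rw [edist_nndist, ENNReal.coe_lt_coe, ← NNReal.coe_lt_coe, coe_nndist, dist_eq_norm] at this
      simpa using this
    rw [← smul_sub, norm_smul, Real.norm_two]
    linarith

theorem exists_finset_isCover_card_le {E : Type*} [NormedAddCommGroup E] [NormedSpace ℝ E]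
    [FiniteDimensional ℝ E] {A : Set E} (hA : A ⊆ closedBall 0 1) :
    ∃ S : Finset E, S.card ≤ 5 ^ finrank ℝ E ∧ ↑S ⊆ A ∧ IsCover (1 / 2) A (S : Set E) := by
  have hle := (coveringNumber_le_packingNumber (1 / 2) A).trans
    (packingNumber_le_five_pow_finrank hA)
  have htop : coveringNumber (1 / 2) A ≠ ⊤ := ne_top_of_le_ne_top (by simp) hle
  obtain ⟨S, hSA, hfin, hcover, hcard⟩ := exists_set_encard_eq_coveringNumber htop
  lift S to Finset E using hfin
  rw [← hcard, Set.encard_coe_eq_coe_finsetCard] at hle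
  exact ⟨S, by exact_mod_cast hle, hSA, hcover⟩

theorem norm_le_two_mul_of_isCover_sphere {E : Type*} [NormedAddCommGroup E]
    [InnerProductSpace ℝ E] {S : Set E} (hS : IsCover (1 / 2) (sphere 0 1) S) {v : E} {M : ℝ}
    (hM₀ : 0 ≤ M) (hM : ∀ ξ ∈ S, |inner ℝ ξ v| ≤ M) : ‖v‖ ≤ 2 * M := by
  rcases eq_or_ne v 0 with rfl | hv
  · simpa using hM₀
  obtain ⟨ξ, hξ, hdist⟩ := hS (show ‖v‖⁻¹ • v ∈ sphere (0 : E) 1 by simp [norm_smul, hv])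
  have hdist' : ‖‖v‖⁻¹ • v - ξ‖ ≤ 1 / 2 := by
    have : edist (‖v‖⁻¹ • v) ξ ≤ ((1 / 2 : NNReal) : ℝ≥0∞) := hdist
    rw [edist_nndist, ENNReal.coe_le_coe, ← NNReal.coe_le_coe, coe_nndist, dist_eq_norm] at this
    simpa using this
  have hnorm : inner ℝ (‖v‖⁻¹ • v) v = ‖v‖ := by
    rw [real_inner_smul_left, real_inner_self_eq_norm_sq]
    field_simp
  have hle : ‖v‖ ≤ 1 / 2 * ‖v‖ + M :=
    calc ‖v‖ = inner ℝ (‖v‖⁻¹ • v - ξ) v + inner ℝ ξ v := by rw [inner_sub_left, hnorm]; ring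
      _ ≤ 1 / 2 * ‖v‖ + M :=
        add_le_add ((real_inner_le_norm _ _).trans (by gcongr)) ((le_abs_self _).trans (hM ξ hξ))
  linarith

/-- The constant is `2 · 2 ^ 2`: the real and imaginary parts of `v` are controlled separately. -/
theorem sum_norm_sq_le_of_isCover_sphere {ι : Type*} [Fintype ι] {S : Set (EuclideanSpace ℝ ι)}
    (hS : IsCover (1 / 2) (sphere 0 1) S) {v : ι → ℂ} {M : ℝ} (hM₀ : 0 ≤ M)
    (hM : ∀ ξ ∈ S, ‖∑ i, (ξ i : ℂ) * v i‖ ≤ M) : ∑ i, ‖v i‖ ^ 2 ≤ 8 * M ^ 2 := by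
  have hre : ‖WithLp.toLp 2 fun i => (v i).re‖ ≤ 2 * M := by
    refine norm_le_two_mul_of_isCover_sphere hS hM₀ fun ξ hξ => ?_
    refine (le_of_eq ?_).trans ((Complex.abs_re_le_norm _).trans (hM ξ hξ))
    simp [PiLp.inner_apply, mul_comm]
  have him : ‖WithLp.toLp 2 fun i => (v i).im‖ ≤ 2 * M := by
    refine norm_le_two_mul_of_isCover_sphere hS hM₀ fun ξ hξ => ?_
    refine (le_of_eq ?_).trans ((Complex.abs_im_le_norm _).trans (hM ξ hξ))
    simp [PiLp.inner_apply, mul_comm]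
  calc ∑ i, ‖v i‖ ^ 2
      = ‖WithLp.toLp 2 fun i => (v i).re‖ ^ 2 + ‖WithLp.toLp 2 fun i => (v i).im‖ ^ 2 := by
        simp only [Complex.sq_norm, Complex.normSq_apply, Finset.sum_add_distrib,
          EuclideanSpace.real_norm_sq_eq, ← sq]
    _ ≤ (2 * M) ^ 2 + (2 * M) ^ 2 := by gcongr
    _ = 8 * M ^ 2 := by ring

end Nets

section Gaussian

theorem lintegral_exp_mul_sq_gaussianReal {b : ℝ} (hb : b < 1 / 2) :
    ∫⁻ x, ENNReal.ofReal (Real.exp (b * x ^ 2)) ∂(gaussianReal 0 1) =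
      ENNReal.ofReal (√(1 / (1 - 2 * b))) := by
  have hc : 0 < 1 / 2 - b := by linarith
  have hdensity : ∀ x : ℝ,
      (gaussianPDF 0 1 * fun x => ENNReal.ofReal (Real.exp (b * x ^ 2))) x =
        ENNReal.ofReal ((√(2 * Real.pi))⁻¹ * Real.exp (-(1 / 2 - b) * x ^ 2)) := fun x => by
    rw [Pi.mul_apply, gaussianPDF, gaussianPDFReal, ← ENNReal.ofReal_mul (by positivity), mul_assoc,
      ← Real.exp_add]
    simp only [sub_zero, NNReal.coe_one, mul_one]
    ring_nf
  rw [gaussianReal_of_var_ne_zero _ one_ne_zero,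
    lintegral_withDensity_eq_lintegral_mul _ (measurable_gaussianPDF 0 1) (by fun_prop)]
  simp_rw [hdensity]
  rw [← ofReal_integral_eq_lintegral_ofReal
    ((integrable_exp_neg_mul_sq hc).const_mul _) (ae_of_all _ fun x => by positivity),
    integral_const_mul, integral_gaussian, ← Real.sqrt_inv, ← Real.sqrt_mul (by positivity)]
  have hpi := Real.pi_ne_zero
  have hb' : 1 - 2 * b ≠ 0 := by linarith
  congr 2
  field_simp

theorem lintegral_prod_pi_const {ι α : Type*} [Fintype ι] [MeasurableSpace α] (μ : Measure α)
    [IsProbabilityMeasure μ] {f : α → ℝ≥0∞} (hf : Measurable f) :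
    ∫⁻ x, ∏ i, f (x i) ∂(Measure.pi fun _ : ι => μ) = (∫⁻ x, f x ∂μ) ^ Fintype.card ι := by
  rw [lintegral_prod_eq_prod_lintegral_of_indepFun Finset.univ (fun (i : ι) (x : ι → α) => f (x i))
    (iIndepFun_pi fun _ => hf.aemeasurable) (fun i => by fun_prop),
    ← Finset.card_univ, ← Finset.prod_const]
  exact Finset.prod_congr rfl fun i _ =>
    (measurePreserving_eval (fun _ : ι => μ) i).lintegral_comp hf

theorem measure_pi_sum_ge_le {ι α : Type*} [Fintype ι] [MeasurableSpace α] (μ : Measure α)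
    [IsProbabilityMeasure μ] {f : α → ℝ} (hf : Measurable f) (s : ℝ) :
    Measure.pi (fun _ : ι => μ) {x | s ≤ ∑ i, f (x i)} ≤
      (∫⁻ x, ENNReal.ofReal (Real.exp (f x)) ∂μ) ^ Fintype.card ι
        * ENNReal.ofReal (Real.exp (-s)) := by
  have hprod : ∀ x : ι → α, ∏ i, ENNReal.ofReal (Real.exp (f (x i))) =
      ENNReal.ofReal (Real.exp (∑ i, f (x i))) := fun x => by
    rw [← ENNReal.ofReal_prod_of_nonneg (fun i _ => (Real.exp_pos _).le), Real.exp_sum]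
  have hmarkov := meas_ge_le_lintegral_div (μ := Measure.pi fun _ : ι => μ)
    (f := fun x => ∏ i, ENNReal.ofReal (Real.exp (f (x i)))) (ε := ENNReal.ofReal (Real.exp s))
    (Measurable.aemeasurable (by fun_prop)) (by simpa using Real.exp_pos s) ENNReal.ofReal_ne_top
  rw [lintegral_prod_pi_const μ (f := fun x => ENNReal.ofReal (Real.exp (f x))) (by fun_prop),
    div_eq_mul_inv, ← ENNReal.ofReal_inv_of_pos (Real.exp_pos s), ← Real.exp_neg] at hmarkov
  simpa only [hprod, ENNReal.ofReal_le_ofReal_iff (Real.exp_pos _).le, Real.exp_le_exp]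
    using hmarkov

theorem map_adjoint_stdGaussian {E F : Type*}
    [NormedAddCommGroup E] [InnerProductSpace ℝ E] [FiniteDimensional ℝ E] [MeasurableSpace E]
    [BorelSpace E] [NormedAddCommGroup F] [InnerProductSpace ℝ F] [FiniteDimensional ℝ F]
    [MeasurableSpace F] [BorelSpace F] (T : F →ₗᵢ[ℝ] E) :
    (stdGaussian E).map T.toContinuousLinearMap.adjoint = stdGaussian F := by
  refine Measure.ext_of_charFun (E := F) (funext fun y => ?_)
  rw [charFun_stdGaussian, charFun_apply, integral_map (by fun_prop)
    (Measurable.aestronglyMeasurable (by fun_prop))]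
  simp_rw [ContinuousLinearMap.adjoint_inner_left]
  rw [← charFun_apply, charFun_stdGaussian]
  simp

theorem measure_pi_gaussianReal_sum_sq_le_le (ι : Type*) [Fintype ι] :
    Measure.pi (fun _ : ι => gaussianReal 0 1) {x | ∑ i, x i ^ 2 ≤ Fintype.card ι / 5000} ≤
      ENNReal.ofReal ((3 / 10) ^ Fintype.card ι) := by
  set N := Fintype.card ι
  have hmoment : ∫⁻ x, ENNReal.ofReal (Real.exp (-50 * x ^ 2)) ∂(gaussianReal 0 1) ≤
      ENNReal.ofReal (1 / 10) := by
    rw [lintegral_exp_mul_sq_gaussianReal (by norm_num)]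
    exact ENNReal.ofReal_le_ofReal (Real.sqrt_le_iff.2 ⟨by norm_num, by norm_num⟩)
  have hexp : Real.exp (1 / 100) ≤ 3 :=
    (Real.exp_le_exp.2 (by norm_num)).trans (Real.exp_one_lt_d9.le.trans (by norm_num))
  have hsub : {x : ι → ℝ | ∑ i, x i ^ 2 ≤ N / 5000} ⊆
      {x | -((N : ℝ) / 100) ≤ ∑ i, -50 * x i ^ 2} := fun x (hx : ∑ i, x i ^ 2 ≤ N / 5000) => by
    rw [Set.mem_ofPred_eq, ← Finset.mul_sum]
    linarith
  calc Measure.pi (fun _ : ι => gaussianReal 0 1) {x | ∑ i, x i ^ 2 ≤ N / 5000}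
      ≤ (∫⁻ x, ENNReal.ofReal (Real.exp (-50 * x ^ 2)) ∂(gaussianReal 0 1)) ^ N
          * ENNReal.ofReal (Real.exp (- -(N / 100))) :=
        (measure_mono hsub).trans (measure_pi_sum_ge_le _ (by fun_prop) _)
    _ ≤ ENNReal.ofReal (1 / 10) ^ N * ENNReal.ofReal (3 ^ N) := by
        gcongr
        calc Real.exp (- -(N / 100)) = Real.exp (1 / 100) ^ N := by
              rw [← Real.exp_nat_mul]; ring_nf
          _ ≤ 3 ^ N := by gcongr
    _ = ENNReal.ofReal ((3 / 10) ^ N) := by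
        rw [← ENNReal.ofReal_pow (by norm_num), ← ENNReal.ofReal_mul (by positivity), ← mul_pow]
        norm_num

/-- Soft thresholding at level `l ≥ 0`: the signed distance from `x` to the interval `[-l, l]`. It
splits a Gaussian vector into a part bounded by `l` and a part of small `ℓ₂` norm. -/
noncomputable def softThreshold (l x : ℝ) : ℝ := x - max (-l) (min x l)

@[fun_prop]
theorem continuous_softThreshold (l : ℝ) : Continuous (softThreshold l) := by
  unfold softThreshold; fun_prop

theorem softThreshold_zero (x : ℝ) : softThreshold 0 x = x := by
  rcases le_total x 0 with h | h <;> simp [softThreshold, h]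

theorem abs_sub_softThreshold_le {l : ℝ} (hl : 0 ≤ l) (x : ℝ) : |x - softThreshold l x| ≤ l := by
  rw [softThreshold, sub_sub_cancel, abs_le]
  exact ⟨le_max_left _ _, max_le (by linarith) (min_le_right _ _)⟩

theorem softThreshold_sq_le {l : ℝ} (hl : 0 ≤ l) (x : ℝ) :
    softThreshold l x ^ 2 ≤ max 0 (x ^ 2 - l ^ 2) := by
  rw [le_max_iff, softThreshold]
  rcases le_total x (-l) with h | h
  · right
    rw [min_eq_left (by linarith), max_eq_left h]
    nlinarith
  rcases le_total x l with h' | h'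
  · left
    simp [h, h']
  · right
    rw [min_eq_right h', max_eq_right (by linarith)]
    nlinarith

theorem lintegral_exp_softThreshold_sq_le {l : ℝ} (hl : 0 ≤ l) :
    ∫⁻ x, ENNReal.ofReal (Real.exp (softThreshold l x ^ 2 / 4)) ∂(gaussianReal 0 1) ≤
      ENNReal.ofReal (Real.exp (2 * Real.exp (-(l ^ 2 / 4)))) := by
  set w := Real.exp (-(l ^ 2 / 4))
  have hpointwise : ∀ x, ENNReal.ofReal (Real.exp (softThreshold l x ^ 2 / 4)) ≤
      1 + ENNReal.ofReal w * ENNReal.ofReal (Real.exp (1 / 4 * x ^ 2)) := fun x => by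
    rw [← ENNReal.ofReal_mul (by positivity), ← Real.exp_add, ← ENNReal.ofReal_one,
      ← ENNReal.ofReal_add zero_le_one (by positivity)]
    refine ENNReal.ofReal_le_ofReal ?_
    rcases le_max_iff.1 (softThreshold_sq_le hl x) with h | h
    · refine le_add_of_le_of_nonneg (Real.exp_le_one_iff.2 ?_) (Real.exp_pos _).le
      linarith
    · refine le_add_of_nonneg_of_le zero_le_one (Real.exp_le_exp.2 ?_)
      linarith
  have hsqrt : √(1 / (1 - 2 * (1 / 4 : ℝ))) ≤ 2 := Real.sqrt_le_iff.2 ⟨by norm_num, by norm_num⟩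
  calc ∫⁻ x, ENNReal.ofReal (Real.exp (softThreshold l x ^ 2 / 4)) ∂(gaussianReal 0 1)
      ≤ 1 + ENNReal.ofReal w * ENNReal.ofReal (√(1 / (1 - 2 * (1 / 4)))) := by
        refine (lintegral_mono hpointwise).trans_eq ?_
        rw [lintegral_add_left measurable_const, lintegral_const_mul _ (by fun_prop),
          lintegral_exp_mul_sq_gaussianReal (by norm_num), lintegral_const, measure_univ, mul_one]
    _ = ENNReal.ofReal (1 + w * √(1 / (1 - 2 * (1 / 4)))) := by
        rw [← ENNReal.ofReal_mul (by positivity), ← ENNReal.ofReal_one,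
          ← ENNReal.ofReal_add zero_le_one (by positivity)]
    _ ≤ ENNReal.ofReal (Real.exp (2 * w)) := by
        refine ENNReal.ofReal_le_ofReal ?_
        calc 1 + w * √(1 / (1 - 2 * (1 / 4))) ≤ 1 + w * 2 := by gcongr
          _ ≤ Real.exp (2 * w) := by linarith [Real.add_one_le_exp (2 * w)]

theorem five_le_exp_two : (5 : ℝ) ≤ Real.exp 2 := by
  have : Real.exp 2 = Real.exp 1 * Real.exp 1 := by rw [← Real.exp_add]; norm_num
  nlinarith [Real.exp_one_gt_d9]

end Gaussian

section GaussianMatrix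

open Metric

variable {n m : ℕ}

/-- The real matrix with entries `g (i, j)`, so that `imageOfIdentity g` is the complexification of
`(toMatrix g)ᵀ * toMatrix g`. -/
def toMatrix (g : Fin n × Fin m → ℝ) : Matrix (Fin n) (Fin m) ℝ :=
  Matrix.of (Function.curry g)

@[fun_prop]
theorem continuous_toMatrix : Continuous (toMatrix (n := n) (m := m)) :=
  continuous_matrix fun i j => continuous_apply (i, j)

instance : IsProbabilityMeasure (gaussianMatrix n m) := by
  unfold gaussianMatrix; infer_instance

theorem map_vecMul_gaussianMatrix {ξ : EuclideanSpace ℝ (Fin n)} (hξ : ‖ξ‖ = 1) :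
    (gaussianMatrix n m).map (fun g => ξ ᵥ* toMatrix g) =
      Measure.pi fun _ : Fin m => gaussianReal 0 1 := by
  let T : EuclideanSpace ℝ (Fin m) →ₗᵢ[ℝ] EuclideanSpace ℝ (Fin n × Fin m) :=
    { toFun := fun y => WithLp.toLp 2 fun p => ξ p.1 * y p.2
      map_add' := fun y z => by ext p; simp [mul_add]
      map_smul' := fun c y => by ext p; simp [mul_left_comm]
      norm_map' := fun y => by
        have hsq : ‖WithLp.toLp 2 fun p : Fin n × Fin m => ξ p.1 * y p.2‖ ^ 2 = ‖y‖ ^ 2 := by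
          simp only [EuclideanSpace.real_norm_sq_eq, Fintype.sum_prod_type, mul_pow,
            ← Finset.mul_sum, ← Finset.sum_mul]
          rw [← EuclideanSpace.real_norm_sq_eq, hξ, one_pow, one_mul]
        exact (pow_left_inj₀ (norm_nonneg _) (norm_nonneg _) two_ne_zero).1 hsq }
  have hadjoint : ∀ g : Fin n × Fin m → ℝ,
      T.toContinuousLinearMap.adjoint (WithLp.toLp 2 g) = WithLp.toLp 2 (ξ ᵥ* toMatrix g) := by
    refine fun g => ext_inner_right ℝ fun y => ?_
    rw [ContinuousLinearMap.adjoint_inner_left]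
    simp only [T, PiLp.inner_apply, Fintype.sum_prod_type_right, RCLike.inner_apply, conj_trivial,
      Matrix.vecMul, dotProduct, toMatrix, Matrix.of_apply, Function.curry, Finset.mul_sum,
      LinearIsometry.coe_toContinuousLinearMap, LinearIsometry.coe_mk, LinearMap.coe_mk,
      AddHom.coe_mk]
    exact Finset.sum_congr rfl fun j _ => Finset.sum_congr rfl fun i _ => by ring
  have hmap := congrArg (Measure.map WithLp.ofLp) (map_adjoint_stdGaussian T)
  rw [← map_pi_eq_stdGaussian, ← map_pi_eq_stdGaussian,
    Measure.map_map (by fun_prop) (by fun_prop), Measure.map_map (by fun_prop) (by fun_prop),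
    Measure.map_map (by fun_prop) (by fun_prop)] at hmap
  simpa [Function.comp_def, hadjoint, Measure.map_id', gaussianMatrix] using hmap

theorem measure_exists_sum_softThreshold_sq_ge_le {S : Finset (EuclideanSpace ℝ (Fin n))}
    (hS : ↑S ⊆ sphere (0 : EuclideanSpace ℝ (Fin n)) 1) {l : ℝ} (hl : 0 ≤ l) (s : ℝ) :
    gaussianMatrix n m {g | ∃ ξ ∈ S, 4 * s ≤ ∑ j, softThreshold l ((ξ ᵥ* toMatrix g) j) ^ 2} ≤
      S.card * ENNReal.ofReal (Real.exp (2 * (m * Real.exp (-(l ^ 2 / 4))) - s)) := by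
  have hpi : Measure.pi (fun _ : Fin m => gaussianReal 0 1)
      {x | s ≤ ∑ j, softThreshold l (x j) ^ 2 / 4} ≤
        ENNReal.ofReal (Real.exp (2 * (m * Real.exp (-(l ^ 2 / 4))) - s)) := by
    refine (measure_pi_sum_ge_le _ (f := fun x => softThreshold l x ^ 2 / 4)
      (by fun_prop) s).trans ?_
    rw [Fintype.card_fin, sub_eq_add_neg, Real.exp_add, ENNReal.ofReal_mul (by positivity),
      mul_left_comm 2, Real.exp_nat_mul, ENNReal.ofReal_pow (by positivity)]
    gcongr
    exact lintegral_exp_softThreshold_sq_le hl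
  have hsingle : ∀ ξ ∈ S,
      gaussianMatrix n m {g | 4 * s ≤ ∑ j, softThreshold l ((ξ ᵥ* toMatrix g) j) ^ 2} ≤
        ENNReal.ofReal (Real.exp (2 * (m * Real.exp (-(l ^ 2 / 4))) - s)) := fun ξ hξ => by
    rw [← map_vecMul_gaussianMatrix (mem_sphere_zero_iff_norm.1 (hS hξ)),
      Measure.map_apply (continuous_const.matrix_vecMul continuous_toMatrix).measurable
        (measurableSet_le (by fun_prop) (by fun_prop))] at hpi
    refine (measure_mono fun g hg => ?_).trans hpi
    rw [Set.mem_preimage, Set.mem_ofPred_eq, ← Finset.sum_div, le_div_iff₀' four_pos]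
    exact hg
  have hunion : {g : Fin n × Fin m → ℝ | ∃ ξ ∈ S, 4 * s ≤
      ∑ j, softThreshold l ((ξ ᵥ* toMatrix g) j) ^ 2} =
        ⋃ ξ ∈ S, {g | 4 * s ≤ ∑ j, softThreshold l ((ξ ᵥ* toMatrix g) j) ^ 2} := by
    ext
    simp
  rw [hunion]
  refine (measure_biUnion_finset_le _ _).trans ((Finset.sum_le_sum hsingle).trans_eq ?_)
  rw [Finset.sum_const, nsmul_eq_mul]

/-- The typical behaviour of an `n × m` Gaussian matrix, tested on a net `S` of the unit sphere:
after soft thresholding at level `l` the combinations of the rows have `ℓ₂` norm of order `√n`,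
before thresholding it is of order `√m`, and the Hilbert–Schmidt norm is of order `√(n * m)`. -/
structure IsTypical (S : Finset (EuclideanSpace ℝ (Fin n))) (l B : ℝ)
    (A : Matrix (Fin n) (Fin m) ℝ) : Prop where
  sum_softThreshold_sq_lt : ∀ ξ ∈ S, ∑ j, softThreshold l ((ξ ᵥ* A) j) ^ 2 < 4 * (B * n)
  sum_sq_lt : ∀ ξ ∈ S, ∑ j, (ξ ᵥ* A) j ^ 2 < 4 * (6 * m)
  lt_sum_sq : (n : ℝ) * m / 5000 < ∑ i, ∑ j, A i j ^ 2

theorem isOpen_setOf_isTypical (S : Finset (EuclideanSpace ℝ (Fin n))) (l B : ℝ) :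
    IsOpen {A : Matrix (Fin n) (Fin m) ℝ | IsTypical S l B A} := by
  have hset : {A : Matrix (Fin n) (Fin m) ℝ | IsTypical S l B A} =
      (⋂ ξ ∈ S, {A | ∑ j, softThreshold l ((ξ ᵥ* A) j) ^ 2 < 4 * (B * n)}) ∩
        (⋂ ξ ∈ S, {A | ∑ j, (ξ ᵥ* A) j ^ 2 < 4 * (6 * m)}) ∩
          {A | (n : ℝ) * m / 5000 < ∑ i, ∑ j, A i j ^ 2} := by
    ext A
    simp only [Set.mem_ofPred_eq, Set.mem_inter_iff, Set.mem_iInter]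
    exact ⟨fun h => ⟨⟨h.1, h.2⟩, h.3⟩, fun h => ⟨h.1.1, h.1.2, h.2⟩⟩
  have hvecMul (ξ : Fin n → ℝ) (j : Fin m) :
      Continuous fun A : Matrix (Fin n) (Fin m) ℝ => (ξ ᵥ* A) j :=
    (continuous_apply j).comp (continuous_const.matrix_vecMul continuous_id)
  rw [hset]
  refine ((isOpen_biInter_finset fun ξ _ => isOpen_lt ?_ continuous_const).inter
    (isOpen_biInter_finset fun ξ _ => isOpen_lt ?_ continuous_const)).inter
      (isOpen_lt continuous_const ?_)
  · exact continuous_finsetSum _ fun j _ =>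
      ((continuous_softThreshold l).comp (hvecMul ξ j)).pow 2
  · exact continuous_finsetSum _ fun j _ => (hvecMul ξ j).pow 2
  · exact continuous_finsetSum _ fun i _ => continuous_finsetSum _ fun j _ =>
      (continuous_id.matrix_elem i j).pow 2

theorem natCast_mul_ofReal_exp_le {N n : ℕ} (hN : N ≤ 5 ^ n) {r : ℝ} (hr : n * 2 + r ≤ -2) :
    (N : ℝ≥0∞) * ENNReal.ofReal (Real.exp r) ≤ ENNReal.ofReal (1 / 4) := by
  have hN' : (N : ℝ) ≤ Real.exp (n * 2) := by
    rw [Real.exp_nat_mul]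
    calc (N : ℝ) ≤ 5 ^ n := by exact_mod_cast hN
      _ ≤ Real.exp 2 ^ n := pow_le_pow_left₀ (by norm_num) five_le_exp_two n
  rw [← ENNReal.ofReal_natCast, ← ENNReal.ofReal_mul (by positivity)]
  refine ENNReal.ofReal_le_ofReal ?_
  calc N * Real.exp r ≤ Real.exp (n * 2) * Real.exp r := by gcongr
    _ ≤ Real.exp (-2) := by rw [← Real.exp_add]; exact Real.exp_le_exp.2 hr
    _ ≤ 1 / 4 := by
      rw [Real.exp_neg, one_div]
      exact inv_anti₀ four_pos (by linarith [five_le_exp_two])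

theorem exists_isTypical (hn : 1 ≤ n) (hnm : n ≤ m) {S : Finset (EuclideanSpace ℝ (Fin n))}
    (hcard : S.card ≤ 5 ^ n) (hS : ↑S ⊆ sphere (0 : EuclideanSpace ℝ (Fin n)) 1) {l K : ℝ}
    (hl : 0 ≤ l) (hK : m * Real.exp (-(l ^ 2 / 4)) ≤ K) :
    ∃ A : Matrix (Fin n) (Fin m) ℝ, IsTypical S l (2 * K + 4) A := by
  have hn' : (1 : ℝ) ≤ n := by exact_mod_cast hn
  have hnm' : (n : ℝ) ≤ m := by exact_mod_cast hnm
  have hK₀ : 0 ≤ K := le_trans (by positivity) hK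
  have hthreshold := (measure_exists_sum_softThreshold_sq_ge_le (m := m) hS hl
    ((2 * K + 4) * n)).trans (natCast_mul_ofReal_exp_le hcard (by nlinarith))
  have hfull := (measure_exists_sum_softThreshold_sq_ge_le (m := m) hS le_rfl
    (6 * m)).trans (natCast_mul_ofReal_exp_le hcard (by norm_num; linarith))
  have hlower : gaussianMatrix n m {g | ∑ p, g p ^ 2 ≤ Fintype.card (Fin n × Fin m) / 5000} ≤
      ENNReal.ofReal (3 / 10) :=
    (measure_pi_gaussianReal_sum_sq_le_le _).trans <| ENNReal.ofReal_le_ofReal <|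
      pow_le_of_le_one (by norm_num) (by norm_num) (by simp; omega)
  by_contra! hnone
  have hcover : Set.univ ⊆
      {g | ∃ ξ ∈ S, 4 * ((2 * K + 4) * n) ≤ ∑ j, softThreshold l ((ξ ᵥ* toMatrix g) j) ^ 2} ∪
      {g | ∃ ξ ∈ S, 4 * (6 * (m : ℝ)) ≤ ∑ j, softThreshold 0 ((ξ ᵥ* toMatrix g) j) ^ 2} ∪
      {g | ∑ p, g p ^ 2 ≤ Fintype.card (Fin n × Fin m) / 5000} := fun g _ => by
    by_contra hg
    simp only [Set.mem_union, Set.mem_ofPred_eq, not_or, not_exists, not_and, not_le,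
      softThreshold_zero, Fintype.card_prod, Fintype.card_fin, Nat.cast_mul,
      Fintype.sum_prod_type] at hg
    exact hnone (toMatrix g) ⟨hg.1.1, hg.1.2, hg.2⟩
  have hprob : (1 : ℝ≥0∞) < 1 := calc
    1 = gaussianMatrix n m Set.univ := measure_univ.symm
    _ ≤ ENNReal.ofReal (1 / 4) + ENNReal.ofReal (1 / 4) + ENNReal.ofReal (3 / 10) :=
      (measure_mono hcover).trans <| (measure_union_le _ _).trans <|
        add_le_add ((measure_union_le _ _).trans (add_le_add hthreshold hfull)) hlower
    _ < 1 := by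
      rw [← ENNReal.ofReal_add (by norm_num) (by norm_num),
        ← ENNReal.ofReal_add (by norm_num) (by norm_num), ENNReal.ofReal_lt_one]
      norm_num
  exact hprob.false

instance : (gaussianReal 0 1).IsOpenPosMeasure :=
  (gaussianReal_absolutelyContinuous' 0 one_ne_zero).isOpenPosMeasure

instance : (gaussianMatrix n m).IsOpenPosMeasure := by
  unfold gaussianMatrix; infer_instance

theorem gaussianMatrix_pos_of_isOpen {U : Set (Matrix (Fin n) (Fin m) ℝ)} (hU : IsOpen U)
    (hne : U.Nonempty) : 0 < gaussianMatrix n m {g | toMatrix g ∈ U} := by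
  obtain ⟨A, hA⟩ := hne
  exact (hU.preimage continuous_toMatrix).measure_pos _ ⟨Function.uncurry A, hA⟩

end GaussianMatrix

section Rank

open scoped ComplexOrder

/-- Perturb along the partial permutation matrix of `e`: the determinant then becomes, up to sign,
the value of a characteristic polynomial, which has finitely many roots. -/
theorem dense_setOf_det_submatrix_ne_zero {ι κ 𝕜 : Type*} [Fintype ι] [DecidableEq ι]
    [NontriviallyNormedField 𝕜] (e : ι ↪ κ) :
    Dense {A : Matrix ι κ 𝕜 | (A.submatrix id e).det ≠ 0} := by
  classical
  refine dense_iff_inter_open.2 fun U hU ⟨A₀, hA₀⟩ => ?_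
  let γ : 𝕜 → Matrix ι κ 𝕜 := fun ε => A₀ - ε • Matrix.of fun i j => if e i = j then 1 else 0
  have hγ : γ ⁻¹' U ∈ nhds 0 :=
    (hU.preimage (by fun_prop)).mem_nhds (by simpa [γ] using hA₀)
  obtain ⟨ε, hεU, hroot⟩ := (infinite_of_mem_nhds 0 hγ).exists_notMem_finite
    (Polynomial.finite_setOfPred_isRoot (A₀.submatrix id e).charpoly_monic.ne_zero)
  refine ⟨γ ε, hεU, fun hdet => hroot ?_⟩
  have hneg : Matrix.scalar ι ε - A₀.submatrix id e = -(γ ε).submatrix id e := by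
    ext i j
    by_cases hij : i = j <;> simp [γ, hij, Matrix.scalar_apply]
  rw [Set.mem_ofPred_eq, Polynomial.IsRoot, Matrix.eval_charpoly, hneg, Matrix.det_neg, hdet,
    mul_zero]

theorem isOpen_setOf_det_submatrix_ne_zero {ι κ 𝕜 : Type*} [Fintype ι] [DecidableEq ι]
    [NontriviallyNormedField 𝕜] (e : ι → κ) :
    IsOpen {A : Matrix ι κ 𝕜 | (A.submatrix id e).det ≠ 0} :=
  isOpen_ne_fun (continuous_id.matrix_submatrix id e).matrix_det continuous_const

theorem rank_eq_card_of_det_submatrix_ne_zero {ι κ K : Type*} [Fintype ι] [DecidableEq ι]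
    [Fintype κ] [Field K] {A : Matrix ι κ K} {e : ι → κ} (h : (A.submatrix id e).det ≠ 0) :
    A.rank = Fintype.card ι := by
  refine le_antisymm A.rank_le_card_height ?_
  rw [← Matrix.rank_of_isUnit _ ((Matrix.isUnit_iff_isUnit_det _).2 h.isUnit)]
  exact Matrix.rank_submatrix_le _ _ _

variable {n m : ℕ}

theorem imageOfIdentity_eq_transpose_mul (g : Fin n × Fin m → ℝ) :
    imageOfIdentity g =
      ((toMatrix g).map (Complex.ofReal))ᵀ * (toMatrix g).map (Complex.ofReal) := by
  ext j k
  simp [imageOfIdentity, toMatrix, Matrix.mul_apply]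

theorem rank_smul_imageOfIdentity {c : ℂ} (hc : c ≠ 0) {g : Fin n × Fin m → ℝ} {e : Fin n → Fin m}
    (hg : ((toMatrix g).submatrix id e).det ≠ 0) : (c • imageOfIdentity g).rank = n := by
  set A : Matrix (Fin n) (Fin m) ℂ := (toMatrix g).map Complex.ofReal with hA
  have hdet : (A.submatrix id e).det ≠ 0 := by
    rw [hA, Matrix.submatrix_map, show ((toMatrix g).submatrix id e).map Complex.ofReal =
      Complex.ofRealHom.mapMatrix ((toMatrix g).submatrix id e) from rfl, ← RingHom.map_det]
    simpa using hg
  have hconj : Aᵀ = Aᴴ := by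
    ext i j
    simp [hA]
  rw [Matrix.rank_smul_of_mem_nonZeroDivisors _ (mem_nonZeroDivisors_of_ne_zero hc),
    imageOfIdentity_eq_transpose_mul, ← hA, hconj, Matrix.rank_conjTranspose_mul_self,
    rank_eq_card_of_det_submatrix_ne_zero hdet, Fintype.card_fin]

end Rank

section KroneckerNorm

variable {ι κ σ : Type*} [Fintype ι] [DecidableEq ι] [Fintype κ] [DecidableEq κ] [Fintype σ]

theorem norm_submatrix_equiv_le (e : κ ≃ ι) (A : Matrix ι ι ℂ) : ‖A.submatrix e e‖ ≤ ‖A‖ := by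
  let f : Matrix ι ι ℂ →⋆ₙₐ[ℂ] Matrix κ κ ℂ :=
    { toFun := fun A => A.submatrix e e
      map_smul' := fun _ _ => rfl
      map_zero' := rfl
      map_add' := fun _ _ => rfl
      map_mul' := fun A B => (Matrix.submatrix_mul_equiv A B e e e).symm
      map_star' := fun _ => rfl }
  exact NonUnitalStarAlgHom.norm_apply_le f A

theorem norm_sum_kronecker_swap_le (A : σ → Matrix ι ι ℂ) (B : σ → Matrix κ κ ℂ) :
    ‖∑ s, A s ⊗ₖ B s‖ ≤ ‖∑ s, B s ⊗ₖ A s‖ := by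
  have hswap : ∑ s, A s ⊗ₖ B s =
      (∑ s, B s ⊗ₖ A s).submatrix (Equiv.prodComm ι κ) (Equiv.prodComm ι κ) := by
    ext
    simp [Matrix.sum_apply, mul_comm]
  rw [hswap]
  exact norm_submatrix_equiv_le _ _

theorem norm_kronecker_one_le (A : Matrix ι ι ℂ) : ‖A ⊗ₖ (1 : Matrix κ κ ℂ)‖ ≤ ‖A‖ := by
  let f : Matrix ι ι ℂ →⋆ₙₐ[ℂ] Matrix (ι × κ) (ι × κ) ℂ :=
    { toFun := fun A => A ⊗ₖ (1 : Matrix κ κ ℂ)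
      map_smul' := fun c A => Matrix.smul_kronecker c A 1
      map_zero' := Matrix.zero_kronecker _
      map_add' := fun A B => Matrix.add_kronecker A B 1
      map_mul' := fun A B => by rw [← Matrix.mul_kronecker_mul, mul_one]
      map_star' := fun A => by simp [Matrix.star_eq_conjTranspose, Matrix.conjTranspose_kronecker] }
  exact NonUnitalStarAlgHom.norm_apply_le f A

theorem norm_one_kronecker_le (B : Matrix κ κ ℂ) : ‖(1 : Matrix ι ι ℂ) ⊗ₖ B‖ ≤ ‖B‖ := by
  have hswap := norm_sum_kronecker_swap_le (fun _ : Unit => (1 : Matrix ι ι ℂ)) (fun _ => B)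
  simp only [Finset.univ_unique, Finset.sum_const, Finset.card_singleton, one_smul] at hswap
  exact hswap.trans (norm_kronecker_one_le B)

theorem kronecker_eq_mul (A : Matrix ι ι ℂ) (B : Matrix κ κ ℂ) :
    A ⊗ₖ B = (A ⊗ₖ (1 : Matrix κ κ ℂ)) * ((1 : Matrix ι ι ℂ) ⊗ₖ B) := by
  rw [← Matrix.mul_kronecker_mul, mul_one, one_mul]

theorem norm_kronecker_le (A : Matrix ι ι ℂ) (B : Matrix κ κ ℂ) : ‖A ⊗ₖ B‖ ≤ ‖A‖ * ‖B‖ := by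
  rw [kronecker_eq_mul]
  exact norm_mul_le_of_le (norm_kronecker_one_le A) (norm_one_kronecker_le B)

theorem norm_sum_mul_le_sqrt_mul_sqrt (P Q : σ → Matrix ι ι ℂ) :
    ‖∑ s, P s * Q s‖ ≤ √‖∑ s, P s * (P s)ᴴ‖ * √‖∑ s, (Q s)ᴴ * Q s‖ := by
  classical
  let R : Matrix ι (σ × ι) ℂ := Matrix.of fun a p => P p.1 a p.2
  let C : Matrix (σ × ι) ι ℂ := Matrix.of fun p b => Q p.1 p.2 b
  have hPQ : ∑ s, P s * Q s = R * C := by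
    ext
    simp [R, C, Matrix.sum_apply, Matrix.mul_apply, Fintype.sum_prod_type]
  have hPP : ∑ s, P s * (P s)ᴴ = Rᴴᴴ * Rᴴ := by
    ext
    simp [R, Matrix.sum_apply, Matrix.mul_apply, Fintype.sum_prod_type]
  have hQQ : ∑ s, (Q s)ᴴ * Q s = Cᴴ * C := by
    ext
    simp [C, Matrix.sum_apply, Matrix.mul_apply, Fintype.sum_prod_type]
  rw [hPQ, hPP, hQQ, Matrix.l2_opNorm_conjTranspose_mul_self,
    Matrix.l2_opNorm_conjTranspose_mul_self, Matrix.l2_opNorm_conjTranspose,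
    Real.sqrt_mul_self (norm_nonneg _), Real.sqrt_mul_self (norm_nonneg _)]
  exact Matrix.l2_opNorm_mul R C

theorem norm_sum_kronecker_le_row_mul_col (A : σ → Matrix ι ι ℂ) (B : σ → Matrix κ κ ℂ) :
    ‖∑ s, A s ⊗ₖ B s‖ ≤ √‖∑ s, A s * (A s)ᴴ‖ * √‖∑ s, (B s)ᴴ * B s‖ := by
  have hA : ∑ s, (A s * (A s)ᴴ) ⊗ₖ (1 : Matrix κ κ ℂ) = (∑ s, A s * (A s)ᴴ) ⊗ₖ 1 := by
    ext
    simp [Matrix.sum_apply, Finset.sum_mul]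
  have hB : ∑ s, (1 : Matrix ι ι ℂ) ⊗ₖ ((B s)ᴴ * B s) = 1 ⊗ₖ ∑ s, (B s)ᴴ * B s := by
    ext
    simp [Matrix.sum_apply, Finset.mul_sum]
  simp_rw [kronecker_eq_mul (A _) (B _)]
  refine (norm_sum_mul_le_sqrt_mul_sqrt _ _).trans ?_
  simp_rw [Matrix.conjTranspose_kronecker, Matrix.conjTranspose_one, ← Matrix.mul_kronecker_mul,
    mul_one, hA, hB]
  gcongr
  exacts [norm_kronecker_one_le _, norm_one_kronecker_le _]

theorem norm_sum_kronecker_le_col_mul_row (A : σ → Matrix ι ι ℂ) (B : σ → Matrix κ κ ℂ) :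
    ‖∑ s, A s ⊗ₖ B s‖ ≤ √‖∑ s, (A s)ᴴ * A s‖ * √‖∑ s, B s * (B s)ᴴ‖ := by
  rw [mul_comm]
  exact (norm_sum_kronecker_swap_le A B).trans (norm_sum_kronecker_le_row_mul_col B A)

end KroneckerNorm

section OperatorSpaces

variable {m k l : ℕ}

theorem opNorm_eq_norm {ι : Type*} [Fintype ι] [DecidableEq ι] (A : Matrix ι ι ℂ) :
    opNorm A = ‖A‖ :=
  Matrix.l2_opNorm_toEuclideanCLM A

theorem norm_le_linfty (x : MatTuple m k) (j : Fin m) : ‖x j‖ ≤ linfty m k x := by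
  rw [← opNorm_eq_norm]
  exact le_ciSup (f := fun j => opNorm (x j)) (Set.finite_range _).bddAbove j

theorem linfty_le {x : MatTuple m k} {r : ℝ} (hr : 0 ≤ r) (hx : ∀ j, ‖x j‖ ≤ r) :
    linfty m k x ≤ r :=
  Real.iSup_le (fun j => (opNorm_eq_norm (x j)).trans_le (hx j)) hr

theorem linfty_nonneg (x : MatTuple m k) : 0 ≤ linfty m k x :=
  Real.iSup_nonneg fun _ => norm_nonneg _

theorem row_nonneg (x : MatTuple m k) : 0 ≤ row m k x := Real.sqrt_nonneg _

theorem col_nonneg (x : MatTuple m k) : 0 ≤ col m k x := Real.sqrt_nonneg _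

theorem rowAddCol_nonneg (x : MatTuple m k) : 0 ≤ rowAddCol m k x :=
  Real.sInf_nonneg fun _ ⟨y, z, _, hr⟩ => hr ▸ add_nonneg (row_nonneg y) (col_nonneg z)

theorem lone_nonneg (x : MatTuple m k) : 0 ≤ lone m k x :=
  Real.sSup_nonneg fun _ ⟨_, _, _, hr⟩ => hr ▸ norm_nonneg _

theorem rowAddCol_le_row (x : MatTuple m k) : rowAddCol m k x ≤ row m k x := by
  refine csInf_le ⟨0, fun r ⟨y, z, _, hr⟩ => hr ▸ add_nonneg (row_nonneg y) (col_nonneg z)⟩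
    ⟨x, 0, add_zero x, ?_⟩
  simp [col, opNorm]

theorem lone_zero : lone m k 0 = 0 := by
  refine le_antisymm (Real.sSup_le ?_ le_rfl) (lone_nonneg 0)
  rintro _ ⟨l, y, _, rfl⟩
  simp [amplify, opNorm]

theorem kSpace_add_le {t : ℝ} (ht : 0 ≤ t) (x y : MatTuple m k) :
    kSpace t m k (x + y) ≤ linfty m k x + √t * row m k y := by
  have hbdd : BddBelow {r : ℝ | ∃ x₁ x₂ x₃ : MatTuple m k, x₁ + x₂ + x₃ = x + y ∧
      r = linfty m k x₁ + √t * rowAddCol m k x₂ + t * lone m k x₃} := by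
    refine ⟨0, ?_⟩
    rintro _ ⟨x₁, x₂, x₃, _, rfl⟩
    have := linfty_nonneg x₁
    have := rowAddCol_nonneg x₂
    have := lone_nonneg x₃
    positivity
  calc kSpace t m k (x + y) ≤ linfty m k x + √t * rowAddCol m k y + t * lone m k 0 :=
        csInf_le hbdd ⟨x, y, 0, add_zero _, rfl⟩
    _ ≤ linfty m k x + √t * row m k y := by
        rw [lone_zero, mul_zero, add_zero]
        gcongr
        exact rowAddCol_le_row y

theorem amplify_add (U : MatTuple m l) (x y : MatTuple m k) :
    amplify U (x + y) = amplify U x + amplify U y := by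
  simp [amplify, Matrix.add_kronecker, Finset.sum_add_distrib]

theorem amplify_smul (c : ℂ) (U : MatTuple m l) (x : MatTuple m k) :
    amplify (c • U) x = c • amplify U x := by
  simp [amplify, Matrix.kronecker_smul, Finset.smul_sum]

theorem norm_amplify_le_mul_linfty (U : MatTuple m l) (x : MatTuple m k) :
    ‖amplify U x‖ ≤ √m * row m l U * linfty m k x := by
  have hcol : √‖∑ j, (x j)ᴴ * x j‖ ≤ √m * linfty m k x := by
    refine Real.sqrt_le_iff.2 ⟨mul_nonneg (Real.sqrt_nonneg _) (linfty_nonneg x), ?_⟩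
    rw [mul_pow, Real.sq_sqrt m.cast_nonneg]
    refine (norm_sum_le _ _).trans ((Finset.sum_le_card_nsmul _ _ (linfty m k x ^ 2)
      fun j _ => ?_).trans_eq (by simp))
    rw [Matrix.l2_opNorm_conjTranspose_mul_self, ← sq]
    exact pow_le_pow_left₀ (norm_nonneg _) (norm_le_linfty x j) 2
  calc ‖amplify U x‖ ≤ √‖∑ j, (x j)ᴴ * x j‖ * √‖∑ j, U j * (U j)ᴴ‖ :=
        norm_sum_kronecker_le_col_mul_row x U
    _ ≤ √m * linfty m k x * √‖∑ j, U j * (U j)ᴴ‖ := by gcongr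
    _ = √m * row m l U * linfty m k x := by rw [row, opNorm_eq_norm, mul_right_comm]

theorem norm_amplify_le_mul_rowAddCol (U : MatTuple m l) (x : MatTuple m k) :
    ‖amplify U x‖ ≤ max (row m l U) (col m l U) * rowAddCol m k x := by
  rw [← smul_eq_mul, rowAddCol,
    ← Real.sInf_smul_of_nonneg ((row_nonneg U).trans (le_max_left _ _))]
  refine le_csInf (Set.Nonempty.smul_set ⟨_, x, 0, add_zero x, rfl⟩) ?_
  rintro _ ⟨_, ⟨y, z, rfl, rfl⟩, rfl⟩
  simp only [smul_eq_mul, mul_add, amplify_add]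
  refine norm_add_le_of_le ?_ ?_
  · calc ‖amplify U y‖ ≤ row m k y * col m l U := by
          simpa only [row, col, opNorm_eq_norm, amplify] using norm_sum_kronecker_le_row_mul_col y U
      _ ≤ row m k y * max (row m l U) (col m l U) :=
          mul_le_mul_of_nonneg_left (le_max_right _ _) (row_nonneg y)
      _ = max (row m l U) (col m l U) * row m k y := mul_comm _ _
  · calc ‖amplify U z‖ ≤ col m k z * row m l U := by
          simpa only [row, col, opNorm_eq_norm, amplify] using norm_sum_kronecker_le_col_mul_row z U
      _ ≤ col m k z * max (row m l U) (col m l U) :=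
          mul_le_mul_of_nonneg_left (le_max_left _ _) (col_nonneg z)
      _ = max (row m l U) (col m l U) * col m k z := mul_comm _ _

theorem norm_amplify_le_lone {U : MatTuple m l} (hU : linfty m l U ≤ 1) (x : MatTuple m k) :
    ‖amplify U x‖ ≤ lone m k x := by
  refine (norm_sum_kronecker_swap_le x U).trans ?_
  rw [← opNorm_eq_norm]
  refine le_csSup ⟨∑ j, ‖x j‖, ?_⟩ ⟨l, U, hU, rfl⟩
  rintro _ ⟨l, y, hy, rfl⟩
  rw [opNorm_eq_norm]
  refine norm_sum_le_of_le _ fun j _ => (norm_kronecker_le _ _).trans ?_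
  exact mul_le_of_le_one_left (norm_nonneg _) ((norm_le_linfty y j).trans hy)

theorem norm_amplify_le_mul_lone (U : MatTuple m l) (x : MatTuple m k) :
    ‖amplify U x‖ ≤ linfty m l U * lone m k x := by
  rcases (linfty_nonneg U).eq_or_lt with h₀ | hpos
  · have hU : U = 0 := funext fun j => norm_le_zero_iff.1 (h₀ ▸ norm_le_linfty U j)
    rw [← h₀]
    simp [hU, amplify]
  have hr : ‖((linfty m l U : ℝ) : ℂ)⁻¹‖ = (linfty m l U)⁻¹ := by
    rw [norm_inv, Complex.norm_real, Real.norm_of_nonneg hpos.le]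
  have hle := norm_amplify_le_lone (U := ((linfty m l U : ℝ) : ℂ)⁻¹ • U)
    (linfty_le zero_le_one fun j => by
      rw [Pi.smul_apply, norm_smul, hr, inv_mul_le_iff₀ hpos, mul_one]
      exact norm_le_linfty U j) x
  rwa [amplify_smul, norm_smul, hr, inv_mul_le_iff₀ hpos] at hle

theorem norm_amplify_le_mul_kSpace {t a : ℝ} (ha : 0 ≤ a) {U : MatTuple m l}
    (hlinfty : √m * row m l U ≤ a) (hrow : row m l U ≤ a * √t) (hcol : col m l U ≤ a * √t)
    (hlone : linfty m l U ≤ a * t) (x : MatTuple m k) : ‖amplify U x‖ ≤ a * kSpace t m k x := by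
  rw [← smul_eq_mul, kSpace, ← Real.sInf_smul_of_nonneg ha]
  refine le_csInf (Set.Nonempty.smul_set ⟨_, x, 0, 0, by simp, rfl⟩) ?_
  rintro _ ⟨_, ⟨x₁, x₂, x₃, rfl, rfl⟩, rfl⟩
  simp only [smul_eq_mul, mul_add, ← mul_assoc, amplify_add]
  refine norm_add_le_of_le (norm_add_le_of_le ?_ ?_) ?_
  · exact (norm_amplify_le_mul_linfty U x₁).trans
      (mul_le_mul_of_nonneg_right hlinfty (linfty_nonneg x₁))
  · exact (norm_amplify_le_mul_rowAddCol U x₂).trans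
      (mul_le_mul_of_nonneg_right (max_le hrow hcol) (rowAddCol_nonneg x₂))
  · exact (norm_amplify_le_mul_lone U x₃).trans
      (mul_le_mul_of_nonneg_right hlone (lone_nonneg x₃))

theorem norm_of_const (c : ℂ) : ‖(Matrix.of fun _ _ => c : Matrix (Fin 1) (Fin 1) ℂ)‖ = ‖c‖ := by
  have hdiag : (Matrix.of fun _ _ => c : Matrix (Fin 1) (Fin 1) ℂ) =
      Matrix.diagonal fun _ => c := by
    ext i j
    simp [Subsingleton.elim i j]
  rw [hdiag, Matrix.l2_opNorm_diagonal, pi_norm_const]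

theorem baseNorm_kSpace_le {t l : ℝ} (ht : 0 ≤ t) (hl : 0 ≤ l) (h : Fin m → ℝ) :
    baseNorm (kSpace t m) (fun j => (h j : ℂ)) ≤ l + √t * √(∑ j, softThreshold l (h j) ^ 2) := by
  have hsplit : (fun j => Matrix.of fun _ _ => (h j : ℂ) : MatTuple m 1) =
      (fun j => Matrix.of fun _ _ => ((h j - softThreshold l (h j) : ℝ) : ℂ)) +
        fun j => Matrix.of fun _ _ => (softThreshold l (h j) : ℂ) := by
    ext
    simp
  rw [baseNorm, hsplit]
  refine (kSpace_add_le ht _ _).trans (add_le_add ?_ (mul_le_mul_of_nonneg_left ?_ (by positivity)))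
  · refine linfty_le hl fun j => ?_
    rw [norm_of_const, Complex.norm_real]
    exact abs_sub_softThreshold_le hl (h j)
  · refine Real.sqrt_le_sqrt ?_
    rw [opNorm_eq_norm]
    refine norm_sum_le_of_le _ fun j _ => (norm_mul_le _ _).trans_eq ?_
    rw [Matrix.l2_opNorm_conjTranspose, norm_of_const, Complex.norm_real, ← sq, Real.norm_eq_abs,
      sq_abs]

end OperatorSpaces

section TensorNorms

open Metric

variable {m n k l : ℕ}

theorem epsNorm_smul (N : MatNorms m) (c : ℂ) (a : Matrix (Fin m) (Fin m) ℂ) :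
    epsNorm N (c • a) = ‖c‖ * epsNorm N a := by
  rw [epsNorm, epsNorm, ← smul_eq_mul, ← Real.sSup_smul_of_nonneg (norm_nonneg c)]
  congr 1
  ext r
  have hsum (φ ψ : Fin m → ℂ) : ‖∑ i, ∑ j, (c • a) i j * (φ i * ψ j)‖ =
      ‖c‖ * ‖∑ i, ∑ j, a i j * (φ i * ψ j)‖ := by
    simp only [Matrix.smul_apply, smul_eq_mul, mul_assoc, ← Finset.mul_sum, norm_mul]
  simp only [Set.mem_smul_set, Set.mem_ofPred_eq, hsum, smul_eq_mul]
  constructor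
  · rintro ⟨φ, ψ, hφ, hψ, rfl⟩
    exact ⟨_, ⟨φ, ψ, hφ, hψ, rfl⟩, rfl⟩
  · rintro ⟨_, ⟨φ, ψ, hφ, hψ, rfl⟩, rfl⟩
    exact ⟨φ, ψ, hφ, hψ, rfl⟩

theorem norm_dotProduct_sq_le {ι : Type*} [Fintype ι] (v w : ι → ℂ) :
    ‖v ⬝ᵥ w‖ ^ 2 ≤ (∑ i, ‖v i‖ ^ 2) * ∑ i, ‖w i‖ ^ 2 := by
  refine (pow_le_pow_left₀ (norm_nonneg _) (norm_sum_le _ _) 2).trans ?_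
  simp_rw [norm_mul]
  exact Finset.sum_mul_sq_le_sq_mul_sq _ _ _

theorem epsNorm_transpose_mul_self_le {S : Set (EuclideanSpace ℝ (Fin n))}
    (hS : IsCover (1 / 2) (sphere 0 1) S) {N : MatNorms m} {A : Matrix (Fin n) (Fin m) ℂ} {M : ℝ}
    (hM₀ : 0 ≤ M) (hM : ∀ ξ ∈ S, baseNorm N ((fun i => (ξ i : ℂ)) ᵥ* A) ≤ M) :
    epsNorm N (Aᵀ * A) ≤ 8 * M ^ 2 := by
  have hmulVec (φ : Fin m → ℂ) (hφ : IsContractiveFunctional N φ) :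
      ∑ i, ‖(A *ᵥ φ) i‖ ^ 2 ≤ 8 * M ^ 2 :=
    sum_norm_sq_le_of_isCover_sphere hS hM₀ fun ξ hξ =>
      calc ‖(fun i => (ξ i : ℂ)) ⬝ᵥ A *ᵥ φ‖ = ‖φ ⬝ᵥ (fun i => (ξ i : ℂ)) ᵥ* A‖ := by
            rw [Matrix.dotProduct_mulVec, dotProduct_comm]
        _ ≤ M := (hφ _).trans (hM ξ hξ)
  refine Real.sSup_le ?_ (by positivity)
  rintro _ ⟨φ, ψ, hφ, hψ, rfl⟩
  have hbilin : ∑ i, ∑ j, (Aᵀ * A) i j * (φ i * ψ j) = (A *ᵥ φ) ⬝ᵥ (A *ᵥ ψ) :=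
    calc ∑ i, ∑ j, (Aᵀ * A) i j * (φ i * ψ j) = φ ⬝ᵥ (Aᵀ * A) *ᵥ ψ := by
          simp only [dotProduct, Matrix.mulVec, Finset.mul_sum, mul_left_comm]
      _ = (A *ᵥ φ) ⬝ᵥ (A *ᵥ ψ) := by
          rw [← Matrix.mulVec_mulVec, Matrix.dotProduct_mulVec, Matrix.vecMul_transpose]
  rw [hbilin]
  refine le_of_sq_le_sq ?_ (by positivity)
  calc ‖(A *ᵥ φ) ⬝ᵥ (A *ᵥ ψ)‖ ^ 2 ≤ (∑ i, ‖(A *ᵥ φ) i‖ ^ 2) * ∑ i, ‖(A *ᵥ ψ) i‖ ^ 2 :=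
        norm_dotProduct_sq_le _ _
    _ ≤ (8 * M ^ 2) * (8 * M ^ 2) := by gcongr; exacts [hmulVec φ hφ, hmulVec ψ hψ]
    _ = (8 * M ^ 2) ^ 2 := (sq _).symm

theorem l2_opNorm_sq_le_of_isCover_sphere {ι κ : Type*} [Fintype ι] [Fintype κ] [DecidableEq κ]
    {S : Set (EuclideanSpace ℝ ι)} (hS : IsCover (1 / 2) (sphere 0 1) S) {A : Matrix ι κ ℂ} {r : ℝ}
    (hr : 0 ≤ r) (hA : ∀ ξ ∈ S, ∑ j, ‖((fun i => (ξ i : ℂ)) ᵥ* A) j‖ ^ 2 ≤ r) :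
    ‖A‖ ^ 2 ≤ 8 * r := by
  refine (Real.le_sqrt (norm_nonneg _) (by positivity)).1 ?_
  rw [Matrix.l2_opNorm_def]
  refine ContinuousLinearMap.opNorm_le_bound _ (Real.sqrt_nonneg _) fun z => ?_
  refine le_of_sq_le_sq ?_ (by positivity)
  have hz : 0 ≤ r * ‖z‖ ^ 2 := by positivity
  rw [EuclideanSpace.norm_sq_eq]
  calc ∑ i, ‖(A *ᵥ z.ofLp) i‖ ^ 2
      ≤ 8 * √(r * ‖z‖ ^ 2) ^ 2 := by
        refine sum_norm_sq_le_of_isCover_sphere hS (Real.sqrt_nonneg _) fun ξ hξ => ?_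
        refine Real.le_sqrt_of_sq_le ?_
        change ‖(fun i => (ξ i : ℂ)) ⬝ᵥ A *ᵥ z.ofLp‖ ^ 2 ≤ _
        rw [Matrix.dotProduct_mulVec, EuclideanSpace.norm_sq_eq]
        refine (norm_dotProduct_sq_le _ _).trans ?_
        gcongr
        exact hA ξ hξ
    _ = (√(8 * r) * ‖z‖) ^ 2 := by
        rw [mul_pow, Real.sq_sqrt hz, Real.sq_sqrt (by positivity), mul_assoc]

theorem minNorm_smul (N : MatNorms m) (c : ℂ) (a : Matrix (Fin m) (Fin m) ℂ) :
    minNorm N (c • a) = ‖c‖ * minNorm N a := by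
  rw [minNorm, minNorm, ← smul_eq_mul, ← Real.sSup_smul_of_nonneg (norm_nonneg c)]
  congr 1
  ext r
  have hsum {k l : ℕ} (U : MatTuple m k) (V : MatTuple m l) :
      opNorm (∑ i, ∑ j, (c • a) i j • (U i ⊗ₖ V j)) =
        ‖c‖ * opNorm (∑ i, ∑ j, a i j • (U i ⊗ₖ V j)) := by
    simp only [opNorm_eq_norm, Matrix.smul_apply, smul_assoc, ← Finset.smul_sum, norm_smul]
  simp only [Set.mem_smul_set, Set.mem_ofPred_eq, hsum, smul_eq_mul]
  constructor
  · rintro ⟨k, l, U, V, hU, hV, rfl⟩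
    exact ⟨_, ⟨k, l, U, V, hU, hV, rfl⟩, rfl⟩
  · rintro ⟨_, ⟨k, l, U, V, hU, hV, rfl⟩, rfl⟩
    exact ⟨k, l, U, V, hU, hV, rfl⟩

theorem IsCompleteContraction.norm_le {N : MatNorms m} {U : MatTuple m k}
    (hU : IsCompleteContraction N U) (i : Fin m) : ‖U i‖ ≤ N 1 (Pi.single i 1) := by
  have hamplify : amplify U (Pi.single i (1 : Matrix (Fin 1) (Fin 1) ℂ)) =
      (1 : Matrix (Fin 1) (Fin 1) ℂ) ⊗ₖ U i := by
    rw [amplify, Finset.sum_eq_single i (fun j _ hj => by simp [hj]) (by simp), Pi.single_eq_same]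
  have hunit : U i = ((1 : Matrix (Fin 1) (Fin 1) ℂ) ⊗ₖ U i).submatrix
      (Equiv.uniqueProd (Fin k) (Fin 1)).symm (Equiv.uniqueProd (Fin k) (Fin 1)).symm := by
    ext
    simp
  calc ‖U i‖ ≤ ‖(1 : Matrix (Fin 1) (Fin 1) ℂ) ⊗ₖ U i‖ := by
        conv_lhs => rw [hunit]
        exact norm_submatrix_equiv_le _ _
    _ = opNorm (amplify U (Pi.single i 1)) := by rw [hamplify, opNorm_eq_norm]
    _ ≤ N 1 (Pi.single i 1) := hU 1 _

theorem norm_le_minNorm {N : MatNorms m} (a : Matrix (Fin m) (Fin m) ℂ) {U : MatTuple m k}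
    {V : MatTuple m l} (hU : IsCompleteContraction N U) (hV : IsCompleteContraction N V) :
    ‖∑ i, ∑ j, a i j • (U i ⊗ₖ V j)‖ ≤ minNorm N a := by
  rw [← opNorm_eq_norm]
  refine le_csSup ⟨∑ i, ∑ j, ‖a i j‖ * (N 1 (Pi.single i 1) * N 1 (Pi.single j 1)), ?_⟩
    ⟨k, l, U, V, hU, hV, rfl⟩
  rintro _ ⟨k, l, U, V, hU, hV, rfl⟩
  rw [opNorm_eq_norm]
  refine norm_sum_le_of_le _ fun i _ => norm_sum_le_of_le _ fun j _ => ?_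
  rw [norm_smul]
  gcongr
  exact (norm_kronecker_le _ _).trans (mul_le_mul (hU.norm_le i) (hV.norm_le j) (norm_nonneg _)
    ((norm_nonneg _).trans (hU.norm_le i)))

end TensorNorms

section ColumnTuple

variable {m n : ℕ}

/-- The map `e_j ↦ A e_j` from `ℂ^m` to the column operator space `C^n`, realised as the column
`i₀` of `M_n`. The operator norm of `A` controls it on `ℓ_∞^m`, the Hilbert–Schmidt norm on
`R^m + C^m`, and the longest column of `A` on `ℓ_1^m`. -/
def columnTuple (i₀ : Fin n) (A : Matrix (Fin n) (Fin m) ℂ) : MatTuple m n := fun j =>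
  Matrix.vecMulVec (A.col j) (Pi.single i₀ 1)

theorem columnTuple_smul (i₀ : Fin n) (c : ℂ) (A : Matrix (Fin n) (Fin m) ℂ) :
    columnTuple i₀ (c • A) = c • columnTuple i₀ A :=
  funext fun j => Matrix.smul_vecMulVec c (A.col j) _

theorem norm_columnTuple_sq (i₀ : Fin n) (A : Matrix (Fin n) (Fin m) ℂ) (j : Fin m) :
    ‖columnTuple i₀ A j‖ ^ 2 = ∑ i, ‖A i j‖ ^ 2 := by
  have hdiag : (columnTuple i₀ A j)ᴴ * columnTuple i₀ A j =
      Matrix.diagonal (Pi.single i₀ ((∑ i, ‖A i j‖ ^ 2 : ℝ) : ℂ)) := by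
    have hdot : star (A.col j) ⬝ᵥ A.col j = ((∑ i, ‖A i j‖ ^ 2 : ℝ) : ℂ) := by
      simp [dotProduct, Complex.conj_mul']
    rw [columnTuple, Matrix.conjTranspose_vecMulVec, Matrix.vecMulVec_mul_vecMulVec, hdot,
      Matrix.vecMulVec_smul, ← Pi.single_star, star_one, ← Matrix.single_eq_single_vecMulVec_single,
      Matrix.smul_single, smul_eq_mul, mul_one, Matrix.diagonal_single]
  rw [sq, ← Matrix.l2_opNorm_conjTranspose_mul_self, hdiag, Matrix.l2_opNorm_diagonal,
    Pi.norm_single, Complex.norm_real, Real.norm_of_nonneg (by positivity)]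

theorem linfty_columnTuple_le {A : Matrix (Fin n) (Fin m) ℂ} {r : ℝ} (hr : 0 ≤ r)
    (hA : ∀ j, ∑ i, ‖A i j‖ ^ 2 ≤ r ^ 2) (i₀ : Fin n) : linfty m n (columnTuple i₀ A) ≤ r :=
  linfty_le hr fun j => le_of_sq_le_sq ((norm_columnTuple_sq i₀ A j).trans_le (hA j)) hr

theorem col_columnTuple_le (i₀ : Fin n) (A : Matrix (Fin n) (Fin m) ℂ) :
    col m n (columnTuple i₀ A) ≤ √(∑ j, ∑ i, ‖A i j‖ ^ 2) := by
  refine Real.sqrt_le_sqrt ?_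
  rw [opNorm_eq_norm]
  refine norm_sum_le_of_le _ fun j _ => ?_
  rw [Matrix.l2_opNorm_conjTranspose_mul_self, ← sq, norm_columnTuple_sq]

theorem row_columnTuple (i₀ : Fin n) (A : Matrix (Fin n) (Fin m) ℂ) :
    row m n (columnTuple i₀ A) = ‖A‖ := by
  have hsum : ∑ j, columnTuple i₀ A j * (columnTuple i₀ A j)ᴴ = Aᴴᴴ * Aᴴ := by
    ext a b
    simp [columnTuple, Matrix.vecMulVec_mul_vecMulVec, Matrix.sum_apply, Matrix.mul_apply,
      Matrix.vecMulVec_apply]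
  rw [row, opNorm_eq_norm, hsum, Matrix.l2_opNorm_conjTranspose_mul_self,
    Matrix.l2_opNorm_conjTranspose, Real.sqrt_mul_self (norm_nonneg _)]

end ColumnTuple

section ColumnContraction

variable {m n k : ℕ}

theorem norm_amplify_columnTuple_le {A : Matrix (Fin n) (Fin m) ℂ} (hn : 1 ≤ n) (hm : 0 < m)
    {r : ℝ} (hr : 0 ≤ r) (hA : ‖A‖ ≤ r * √m) (hcols : ∀ j, ∑ i, ‖A i j‖ ^ 2 ≤ r ^ 2 * n)
    (i₀ : Fin n) (x : MatTuple m k) :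
    ‖amplify (columnTuple i₀ A) x‖ ≤ r * m * kSpace (n / m) m k x := by
  have hn' : (1 : ℝ) ≤ n := by exact_mod_cast hn
  have hsqrt : m * √(n / m : ℝ) = √m * √n := by
    rw [Real.sqrt_div (Nat.cast_nonneg n)]
    field_simp
    rw [Real.sq_sqrt (Nat.cast_nonneg m)]
  refine norm_amplify_le_mul_kSpace (by positivity) ?_ ?_ ?_ ?_ x
  · rw [row_columnTuple]
    calc √m * ‖A‖ ≤ √m * (r * √m) := by gcongr
      _ = r * (√m * √m) := by ring
      _ = r * m := by rw [Real.mul_self_sqrt (Nat.cast_nonneg m)]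
  · rw [row_columnTuple, mul_assoc, hsqrt]
    refine hA.trans ?_
    gcongr
    exact le_mul_of_one_le_right (Real.sqrt_nonneg _) (Real.one_le_sqrt.2 hn')
  · refine (col_columnTuple_le i₀ A).trans (Real.sqrt_le_iff.2 ⟨by positivity, ?_⟩)
    calc ∑ j, ∑ i, ‖A i j‖ ^ 2 ≤ ∑ _j : Fin m, r ^ 2 * n := Finset.sum_le_sum fun j _ => hcols j
      _ = r ^ 2 * (√m ^ 2 * √n ^ 2) := by
        rw [Real.sq_sqrt (Nat.cast_nonneg m), Real.sq_sqrt (Nat.cast_nonneg n), Finset.sum_const,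
          Finset.card_univ, Fintype.card_fin, nsmul_eq_mul, mul_left_comm]
      _ = (r * m * √(n / m : ℝ)) ^ 2 := by rw [mul_assoc r, hsqrt, mul_pow, mul_pow]
  · refine linfty_columnTuple_le (by positivity) (fun j => (hcols j).trans ?_) i₀
    calc r ^ 2 * n ≤ r ^ 2 * (n * n) := by
          gcongr
          exact le_mul_of_one_le_right (by positivity) hn'
      _ = (r * m * (n / m)) ^ 2 := by field_simp

theorem isCompleteContraction_smul_columnTuple (q : ℝ) {A : Matrix (Fin n) (Fin m) ℂ}
    (hn : 1 ≤ n) (hm : 0 < m) {r : ℝ} (hr : 0 < r) (hA : ‖A‖ ≤ r * √m)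
    (hcols : ∀ j, ∑ i, ‖A i j‖ ^ 2 ≤ r ^ 2 * n) (i₀ : Fin n) :
    IsCompleteContraction (xSpace q (n / m) m)
      ((((n / m : ℝ) ^ (-1 / q) / (r * m) : ℝ) : ℂ) • columnTuple i₀ A) := by
  intro k x
  rw [opNorm_eq_norm, amplify_smul, norm_smul, Complex.norm_real,
    Real.norm_of_nonneg (by positivity), xSpace, div_mul_eq_mul_div, mul_div_assoc]
  gcongr
  rw [div_le_iff₀' (by positivity)]
  exact norm_amplify_columnTuple_le hn hm hr.le hA hcols i₀ x

theorem norm_sum_diag_le (M : Matrix (Fin n × Fin n) (Fin n × Fin n) ℂ) (b : Fin n × Fin n) :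
    ‖∑ p, M (p, p) b‖ ≤ √n * ‖M‖ := by
  have hcol : ∑ p, ‖M p b‖ ^ 2 ≤ ‖M‖ ^ 2 := by
    have hmulVec := M.l2_opNorm_mulVec (EuclideanSpace.single b 1)
    rw [PiLp.norm_single, norm_one, mul_one] at hmulVec
    simpa [EuclideanSpace.norm_sq_eq] using pow_le_pow_left₀ (norm_nonneg _) hmulVec 2
  have hdiag : ∑ p : Fin n, ‖M (p, p) b‖ ^ 2 ≤ ∑ p, ‖M p b‖ ^ 2 := by
    rw [Fintype.sum_prod_type]
    exact Finset.sum_le_sum fun p _ =>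
      Finset.single_le_sum (f := fun s => ‖M (p, s) b‖ ^ 2) (fun _ _ => by positivity)
        (Finset.mem_univ p)
  refine le_of_sq_le_sq ?_ (by positivity)
  calc ‖∑ p, M (p, p) b‖ ^ 2 ≤ (∑ p, ‖M (p, p) b‖) ^ 2 := by gcongr; exact norm_sum_le _ _
    _ ≤ n * ∑ p, ‖M (p, p) b‖ ^ 2 := by
        simpa using sq_sum_le_card_mul_sum_sq (s := Finset.univ) (f := fun p => ‖M (p, p) b‖)
    _ ≤ n * ‖M‖ ^ 2 := by gcongr; exact hdiag.trans hcol
    _ = (√n * ‖M‖) ^ 2 := by rw [mul_pow, Real.sq_sqrt (Nat.cast_nonneg n)]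

theorem norm_trace_le_sqrt_mul_minNorm {N : MatNorms m} {i₀ : Fin n} {A : Matrix (Fin n) (Fin m) ℂ}
    (hA : IsCompleteContraction N (columnTuple i₀ A)) (a : Matrix (Fin m) (Fin m) ℂ) :
    ‖(A * a * Aᵀ).trace‖ ≤ √n * minNorm N a := by
  have htrace : (A * a * Aᵀ).trace =
      ∑ p, (∑ i, ∑ j, a i j • (columnTuple i₀ A i ⊗ₖ columnTuple i₀ A j)) (p, p) (i₀, i₀) := by
    simp only [Matrix.trace, Matrix.diag, Matrix.mul_apply, Matrix.transpose_apply,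
      Matrix.sum_apply, Matrix.smul_apply, Matrix.kroneckerMap_apply, columnTuple,
      Matrix.vecMulVec_apply, Matrix.col_apply, Pi.single_eq_same, smul_eq_mul, mul_one,
      Finset.sum_mul]
    refine Finset.sum_congr rfl fun p _ => ?_
    rw [Finset.sum_comm]
    exact Finset.sum_congr rfl fun i _ => Finset.sum_congr rfl fun j _ => by ring
  rw [htrace]
  refine (norm_sum_diag_le _ _).trans ?_
  gcongr
  exact norm_le_minNorm a hA hA

theorem sq_trace_le_card_mul_trace_mul_self {ι : Type*} [Fintype ι] {B : Matrix ι ι ℝ}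
    (hB : B.IsSymm) : B.trace ^ 2 ≤ Fintype.card ι * (B * B).trace := by
  calc B.trace ^ 2 ≤ Fintype.card ι * ∑ i, B i i ^ 2 := sq_sum_le_card_mul_sum_sq
    _ ≤ Fintype.card ι * (B * B).trace := by
        gcongr
        refine Finset.sum_le_sum fun i _ => ?_
        rw [Matrix.diag_apply, Matrix.mul_apply]
        simp only [hB.apply, ← sq]
        exact Finset.single_le_sum (f := fun j => B i j ^ 2) (fun _ _ => sq_nonneg _)
          (Finset.mem_univ i)

theorem sq_mul_sq_sum_le_mul_minNorm {N : MatNorms m} {i₀ : Fin n} {A : Matrix (Fin n) (Fin m) ℝ}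
    {c : ℝ} (hA : IsCompleteContraction N ((c : ℂ) • columnTuple i₀ (A.map Complex.ofReal))) :
    c ^ 2 * (∑ i, ∑ j, A i j ^ 2) ^ 2 ≤
      n * (√n * minNorm N ((A.map Complex.ofReal)ᵀ * A.map Complex.ofReal)) := by
  rw [← columnTuple_smul] at hA
  set Aℂ : Matrix (Fin n) (Fin m) ℂ := A.map Complex.ofReal
  have hsum : ∑ i, ∑ j, A i j ^ 2 = (A * Aᵀ).trace := by
    simp [Matrix.trace, Matrix.mul_apply, sq]
  have htrace : (((c : ℂ) • Aℂ) * (Aℂᵀ * Aℂ) * ((c : ℂ) • Aℂ)ᵀ).trace =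
      ((c ^ 2 * ((A * Aᵀ) * (A * Aᵀ)).trace : ℝ) : ℂ) := by
    have hmap : (((A * Aᵀ) * (A * Aᵀ)).trace : ℂ) = (Aℂ * Aℂᵀ * (Aℂ * Aℂᵀ)).trace := by
      have hmul : (A * Aᵀ).map Complex.ofRealHom = Aℂ * Aℂᵀ := Matrix.map_mul
      rw [← hmul, ← Matrix.map_mul]
      exact AddMonoidHom.map_trace Complex.ofRealHom _
    rw [Complex.ofReal_mul, hmap, Matrix.transpose_smul, Matrix.mul_smul, Matrix.smul_mul,
      Matrix.smul_mul, smul_smul, Matrix.trace_smul, smul_eq_mul, Complex.ofReal_pow, ← sq]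
    simp only [Matrix.mul_assoc]
  calc c ^ 2 * (∑ i, ∑ j, A i j ^ 2) ^ 2 ≤ c ^ 2 * (n * ((A * Aᵀ) * (A * Aᵀ)).trace) := by
        gcongr
        rw [hsum]
        have hsymm : (A * Aᵀ).IsSymm := by
          rw [Matrix.IsSymm, Matrix.transpose_mul, Matrix.transpose_transpose]
        simpa using sq_trace_le_card_mul_trace_mul_self hsymm
    _ = n * (c ^ 2 * ((A * Aᵀ) * (A * Aᵀ)).trace) := mul_left_comm _ _ _
    _ ≤ n * ‖(((c : ℂ) • Aℂ) * (Aℂᵀ * Aℂ) * ((c : ℂ) • Aℂ)ᵀ).trace‖ := by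
        gcongr
        rw [htrace, Complex.norm_real]
        exact le_abs_self _
    _ ≤ n * (√n * minNorm N (Aℂᵀ * Aℂ)) := by
        gcongr
        exact norm_trace_le_sqrt_mul_minNorm hA _

end ColumnContraction

section Exponents

theorem rpow_mul_exp_neg_mul_le {p s x : ℝ} (hp : 0 < p) (hs : 0 < s) (hx : 0 ≤ x) :
    x ^ p * Real.exp (-(s * x)) ≤ (p / s) ^ p := by
  have hexp : s * x / p ≤ Real.exp (s * x / p) :=
    (le_add_of_nonneg_right zero_le_one).trans (Real.add_one_le_exp _)
  have hpow := Real.rpow_le_rpow (by positivity) hexp hp.le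
  rw [← Real.exp_mul, div_mul_cancel₀ _ hp.ne', Real.div_rpow (by positivity) hp.le,
    Real.mul_rpow hs.le hx, div_le_iff₀ (by positivity)] at hpow
  rw [Real.exp_neg, ← div_eq_mul_inv, div_le_iff₀ (Real.exp_pos _),
    Real.div_rpow hp.le hs.le, div_mul_eq_mul_div, le_div_iff₀ (by positivity)]
  linarith

theorem mul_exp_neg_sq_rpow_le {q x y : ℝ} (hq : 0 < q) (hx : 0 ≤ x) (hy : y ≤ 2 * x ^ (q / 2)) :
    y * Real.exp (-((x ^ (1 / q)) ^ 2 / 4)) ≤ 2 * (q ^ 2) ^ (q ^ 2 / 4) := by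
  have hpow : ((x ^ (1 / q)) ^ 2) ^ (q ^ 2 / 4) = x ^ (q / 2) := by
    rw [← Real.rpow_natCast, ← Real.rpow_mul hx, ← Real.rpow_mul hx]
    congr 1
    push_cast
    field_simp
    norm_num
  have hdecay := rpow_mul_exp_neg_mul_le (p := q ^ 2 / 4) (s := 1 / 4) (x := (x ^ (1 / q)) ^ 2)
    (by positivity) (by norm_num) (by positivity)
  rw [hpow, one_div_mul_eq_div, div_div_div_cancel_right₀ four_ne_zero, div_one] at hdecay
  calc y * Real.exp (-((x ^ (1 / q)) ^ 2 / 4))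
      ≤ 2 * x ^ (q / 2) * Real.exp (-((x ^ (1 / q)) ^ 2 / 4)) := by gcongr
    _ ≤ 2 * (q ^ 2) ^ (q ^ 2 / 4) := by rw [mul_assoc]; gcongr

theorem rpow_mul_sq_div_rpow {q x y : ℝ} (hx : 0 ≤ x) (hy : 0 < y) :
    y ^ (-2 / q) * ((x / y) ^ (-1 / q)) ^ 2 = x ^ (-2 / q) := by
  have hsq : ((x / y) ^ (-1 / q)) ^ 2 = (x / y) ^ (-2 / q) := by
    rw [← Real.rpow_natCast, ← Real.rpow_mul (by positivity)]
    congr 1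
    push_cast
    ring
  rw [hsq, ← Real.mul_rpow hy.le (by positivity), mul_div_cancel₀ _ hy.ne']

theorem sqrt_div_mul_sqrt_le_rpow {q x y : ℝ} (hq : 0 < q) (hx : 1 ≤ x) (hy : x ^ (q / 2) ≤ y) :
    √(x / y) * √x ≤ x ^ (1 / q) := by
  have hx₀ : 0 < x := by linarith
  have hexp : 1 - q / 4 ≤ 1 / q := by
    rw [le_div_iff₀ hq]
    linarith [sq_nonneg (q / 2 - 1)]
  calc √(x / y) * √x = x / √y := by
        rw [Real.sqrt_div hx₀.le, div_mul_eq_mul_div, Real.mul_self_sqrt hx₀.le]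
    _ ≤ x / √(x ^ (q / 2)) := by gcongr
    _ = x ^ (1 - q / 4) := by
        rw [Real.sqrt_eq_rpow, ← Real.rpow_mul hx₀.le, Real.rpow_sub hx₀, Real.rpow_one]
        ring_nf
    _ ≤ x ^ (1 / q) := Real.rpow_le_rpow_of_exponent_le hx hexp

end Exponents

section Typical

open Metric

variable {m n : ℕ} {S : Finset (EuclideanSpace ℝ (Fin n))} {l B : ℝ}
  {A : Matrix (Fin n) (Fin m) ℝ}

theorem vecMul_map_ofReal {ι κ : Type*} [Fintype ι] (v : ι → ℝ) (A : Matrix ι κ ℝ) :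
    (fun i => (v i : ℂ)) ᵥ* A.map Complex.ofReal = fun j => (((v ᵥ* A) j : ℝ) : ℂ) :=
  funext fun j => (RingHom.map_vecMul Complex.ofRealHom A v j).symm

theorem IsTypical.sqrt_sum_softThreshold_sq_le (hA : IsTypical S l B A) (hB : 0 ≤ B)
    {ξ : EuclideanSpace ℝ (Fin n)} (hξ : ξ ∈ S) :
    √(∑ j, softThreshold l ((ξ ᵥ* A) j) ^ 2) ≤ 2 * √B * √n := by
  refine Real.sqrt_le_iff.2 ⟨by positivity, ?_⟩
  rw [mul_pow, mul_pow, Real.sq_sqrt hB, Real.sq_sqrt (Nat.cast_nonneg n)]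
  linarith [hA.sum_softThreshold_sq_lt ξ hξ]

theorem IsTypical.abs_vecMul_le (hA : IsTypical S l B A) (hB : 0 ≤ B) (hl : 0 ≤ l) (hln : l ≤ √n)
    {ξ : EuclideanSpace ℝ (Fin n)} (hξ : ξ ∈ S) (j : Fin m) :
    |(ξ ᵥ* A) j| ≤ √n * (1 + 2 * √B) := by
  have hexcess : |softThreshold l ((ξ ᵥ* A) j)| ≤ 2 * √B * √n :=
    (Real.abs_le_sqrt (Finset.single_le_sum (f := fun j => softThreshold l ((ξ ᵥ* A) j) ^ 2)
      (fun _ _ => sq_nonneg _) (Finset.mem_univ j))).trans (hA.sqrt_sum_softThreshold_sq_le hB hξ)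
  have hclip := abs_sub_softThreshold_le hl ((ξ ᵥ* A) j)
  have htriangle := abs_sub_abs_le_abs_sub ((ξ ᵥ* A) j) (softThreshold l ((ξ ᵥ* A) j))
  linarith

theorem IsTypical.sum_norm_sq_le (hA : IsTypical S l B A)
    (hS : IsCover (1 / 2) (sphere 0 1) (S : Set (EuclideanSpace ℝ (Fin n)))) (hB : 0 ≤ B)
    (hl : 0 ≤ l) (hln : l ≤ √n) (j : Fin m) :
    ∑ i, ‖A.map Complex.ofReal i j‖ ^ 2 ≤ 8 * (√n * (1 + 2 * √B)) ^ 2 :=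
  sum_norm_sq_le_of_isCover_sphere hS (by positivity) fun ξ hξ =>
    calc ‖∑ i, (ξ i : ℂ) * A.map Complex.ofReal i j‖ = |(ξ ᵥ* A) j| := by
          rw [← Real.norm_eq_abs, ← Complex.norm_real]
          exact congrArg norm (congrFun (vecMul_map_ofReal ξ.ofLp A) j)
      _ ≤ √n * (1 + 2 * √B) := hA.abs_vecMul_le hB hl hln hξ j

theorem IsTypical.l2_opNorm_sq_le (hA : IsTypical S l B A)
    (hS : IsCover (1 / 2) (sphere 0 1) (S : Set (EuclideanSpace ℝ (Fin n)))) :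
    ‖A.map Complex.ofReal‖ ^ 2 ≤ 8 * (4 * (6 * m)) := by
  refine l2_opNorm_sq_le_of_isCover_sphere hS (by positivity) fun ξ hξ => ?_
  rw [vecMul_map_ofReal ξ.ofLp A]
  simp only [Complex.norm_real, Real.norm_eq_abs, sq_abs]
  exact (hA.sum_sq_lt ξ hξ).le

theorem IsTypical.isCompleteContraction (hA : IsTypical S l B A)
    (hS : IsCover (1 / 2) (sphere 0 1) (S : Set (EuclideanSpace ℝ (Fin n)))) (hB : 4 ≤ B)
    (hl : 0 ≤ l) (hln : l ≤ √n) (q : ℝ) (hn : 1 ≤ n) (hm : 0 < m) (i₀ : Fin n) :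
    IsCompleteContraction (xSpace q (n / m) m)
      ((((n / m : ℝ) ^ (-1 / q) / (3 * (1 + 2 * √B) * m) : ℝ) : ℂ) •
        columnTuple i₀ (A.map Complex.ofReal)) := by
  have hsqrt : 2 ≤ √B := Real.le_sqrt_of_sq_le (by linarith)
  refine isCompleteContraction_smul_columnTuple q hn hm (by positivity) ?_ (fun j => ?_) i₀
  · refine le_of_sq_le_sq ((hA.l2_opNorm_sq_le hS).trans ?_) (by positivity)
    calc (8 * (4 * (6 * m)) : ℝ) ≤ 15 ^ 2 * m := by linarith [Nat.cast_nonneg (α := ℝ) m]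
      _ ≤ (3 * (1 + 2 * √B)) ^ 2 * m := by gcongr; linarith
      _ = (3 * (1 + 2 * √B) * √m) ^ 2 := by rw [mul_pow _ (√m), Real.sq_sqrt (Nat.cast_nonneg m)]
  · refine (hA.sum_norm_sq_le hS (by linarith) hl hln j).trans ?_
    rw [mul_pow, Real.sq_sqrt (Nat.cast_nonneg n), mul_pow]
    have : 0 ≤ n * (1 + 2 * √B) ^ 2 := by positivity
    linarith

theorem IsTypical.rpow_le_minNorm {g : Fin n × Fin m → ℝ} (hg : IsTypical S l B (toMatrix g))
    (hS : IsCover (1 / 2) (sphere 0 1) (S : Set (EuclideanSpace ℝ (Fin n)))) (hB : 4 ≤ B)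
    (hl : 0 ≤ l) (hln : l ≤ √n) (q : ℝ) (hn : 1 ≤ n) (hm : 0 < m) :
    (n : ℝ) ^ (1 / 2 - 2 / q) ≤ minNorm (xSpace q (n / m) m)
      ((((5000 * (3 * (1 + 2 * √B))) ^ 2 * (m : ℝ) ^ (-2 / q) : ℝ) : ℂ) • imageOfIdentity g) := by
  have hn₀ : (0 : ℝ) < n := by exact_mod_cast hn
  have hm₀ : (0 : ℝ) < m := by exact_mod_cast hm
  set β : ℝ := 3 * (1 + 2 * √B) with hβ
  have hβ₀ : 0 < β := by positivity
  set a : ℝ := (n / m : ℝ) ^ (-1 / q) with ha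
  have hcontr := hg.isCompleteContraction hS hB hl hln q hn hm ⟨0, hn⟩
  have hlower := sq_mul_sq_sum_le_mul_minNorm hcontr
  rw [← ha, ← hβ, ← imageOfIdentity_eq_transpose_mul] at hlower
  have hrpow : √(n : ℝ) * (n : ℝ) ^ (1 / 2 - 2 / q) = n * (n : ℝ) ^ (-2 / q) := by
    rw [Real.rpow_sub hn₀, ← Real.sqrt_eq_rpow, ← mul_div_assoc, Real.mul_self_sqrt hn₀.le,
      neg_div, Real.rpow_neg hn₀.le, div_eq_mul_inv]
  rw [minNorm_smul, Complex.norm_real, Real.norm_of_nonneg (by positivity)]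
  refine le_of_mul_le_mul_left ?_ (show 0 < n * √(n : ℝ) by positivity)
  calc n * √n * (n : ℝ) ^ (1 / 2 - 2 / q) = n * (n * (n : ℝ) ^ (-2 / q)) := by
        rw [mul_assoc, hrpow]
    _ = n * (n * ((m : ℝ) ^ (-2 / q) * a ^ 2)) := by rw [rpow_mul_sq_div_rpow hn₀.le hm₀]
    _ = (5000 * β) ^ 2 * (m : ℝ) ^ (-2 / q) * ((a / (β * m)) ^ 2 * (n * m / 5000) ^ 2) := by
        field_simp
    _ ≤ (5000 * β) ^ 2 * (m : ℝ) ^ (-2 / q) *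
          ((a / (β * m)) ^ 2 * (∑ i, ∑ j, toMatrix g i j ^ 2) ^ 2) := by
        gcongr
        exact hg.lt_sum_sq.le
    _ ≤ (5000 * β) ^ 2 * (m : ℝ) ^ (-2 / q) *
          (n * (√n * minNorm (xSpace q (n / m) m) (imageOfIdentity g))) := by gcongr
    _ = n * √n * ((5000 * β) ^ 2 * (m : ℝ) ^ (-2 / q) *
          minNorm (xSpace q (n / m) m) (imageOfIdentity g)) := by ring

theorem IsTypical.baseNorm_xSpace_le {q : ℝ} (hA : IsTypical S ((n : ℝ) ^ (1 / q)) B A)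
    (hB : 0 ≤ B) (hq : 0 < q) (hn : 1 ≤ n) (hnm : (n : ℝ) ^ (q / 2) ≤ m)
    {ξ : EuclideanSpace ℝ (Fin n)} (hξ : ξ ∈ S) :
    baseNorm (xSpace q (n / m) m) ((fun i => (ξ i : ℂ)) ᵥ* A.map Complex.ofReal) ≤
      (n / m : ℝ) ^ (-1 / q) * ((n : ℝ) ^ (1 / q) * (1 + 2 * √B)) := by
  rw [vecMul_map_ofReal ξ.ofLp A]
  refine mul_le_mul_of_nonneg_left ?_ (by positivity)
  calc baseNorm (kSpace (n / m) m) (fun j => (((ξ ᵥ* A) j : ℝ) : ℂ))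
      ≤ (n : ℝ) ^ (1 / q) +
        √(n / m : ℝ) * √(∑ j, softThreshold ((n : ℝ) ^ (1 / q)) ((ξ ᵥ* A) j) ^ 2) :=
        baseNorm_kSpace_le (by positivity) (by positivity) _
    _ ≤ (n : ℝ) ^ (1 / q) + √(n / m : ℝ) * (2 * √B * √n) := by
        gcongr
        exact hA.sqrt_sum_softThreshold_sq_le hB hξ
    _ = (n : ℝ) ^ (1 / q) + √(n / m : ℝ) * √n * (2 * √B) := by ring
    _ ≤ (n : ℝ) ^ (1 / q) + (n : ℝ) ^ (1 / q) * (2 * √B) := by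
        gcongr
        exact sqrt_div_mul_sqrt_le_rpow hq (by exact_mod_cast hn) hnm
    _ = (n : ℝ) ^ (1 / q) * (1 + 2 * √B) := by ring

theorem IsTypical.epsNorm_le {q : ℝ} {g : Fin n × Fin m → ℝ}
    (hg : IsTypical S ((n : ℝ) ^ (1 / q)) B (toMatrix g))
    (hS : IsCover (1 / 2) (sphere 0 1) (S : Set (EuclideanSpace ℝ (Fin n)))) (hB : 0 ≤ B)
    (hq : 0 < q) (hn : 1 ≤ n) (hnm : (n : ℝ) ^ (q / 2) ≤ m) {κ : ℝ} (hκ : 0 ≤ κ) :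
    epsNorm (xSpace q (n / m) m) (((κ * (m : ℝ) ^ (-2 / q) : ℝ) : ℂ) • imageOfIdentity g) ≤
      κ * (8 * (1 + 2 * √B) ^ 2) := by
  have hn₀ : (0 : ℝ) < n := by exact_mod_cast hn
  have hm₀ : (0 : ℝ) < m := (Real.rpow_pos_of_pos hn₀ _).trans_le hnm
  have hcancel : (n : ℝ) ^ (-2 / q) * ((n : ℝ) ^ (1 / q)) ^ 2 = 1 := by
    rw [← Real.rpow_natCast, ← Real.rpow_mul hn₀.le, ← Real.rpow_add hn₀, Nat.cast_ofNat,
      one_div_mul_eq_div, neg_div, neg_add_cancel, Real.rpow_zero]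
  rw [epsNorm_smul, Complex.norm_real, Real.norm_of_nonneg (by positivity),
    imageOfIdentity_eq_transpose_mul]
  calc κ * (m : ℝ) ^ (-2 / q) * epsNorm (xSpace q (n / m) m)
        (((toMatrix g).map Complex.ofReal)ᵀ * (toMatrix g).map Complex.ofReal)
      ≤ κ * (m : ℝ) ^ (-2 / q) *
          (8 * ((n / m : ℝ) ^ (-1 / q) * ((n : ℝ) ^ (1 / q) * (1 + 2 * √B))) ^ 2) := by
        gcongr
        exact epsNorm_transpose_mul_self_le hS (by positivity) fun ξ hξ =>
          hg.baseNorm_xSpace_le hB hq hn hnm hξ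
    _ = κ * (8 * (1 + 2 * √B) ^ 2) * (((m : ℝ) ^ (-2 / q) * ((n / m : ℝ) ^ (-1 / q)) ^ 2) *
          ((n : ℝ) ^ (1 / q)) ^ 2) := by ring
    _ = κ * (8 * (1 + 2 * √B) ^ 2) := by
        rw [rpow_mul_sq_div_rpow hn₀.le hm₀, hcancel, mul_one]

theorem IsTypical.separates {q : ℝ} {g : Fin n × Fin m → ℝ}
    (hg : IsTypical S ((n : ℝ) ^ (1 / q)) B (toMatrix g))
    (hS : IsCover (1 / 2) (sphere 0 1) (S : Set (EuclideanSpace ℝ (Fin n)))) (hB : 4 ≤ B)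
    (hq : 2 ≤ q) (hn : 1 ≤ n) (hnm : (n : ℝ) ^ (q / 2) ≤ m) {e : Fin n → Fin m}
    (hdet : ((toMatrix g).submatrix id e).det ≠ 0) :
    Separates q ((5000 * (3 * (1 + 2 * √B))) ^ 2 * (8 * (1 + 2 * √B) ^ 2)) n m
      ((((5000 * (3 * (1 + 2 * √B))) ^ 2 * (m : ℝ) ^ (-2 / q) : ℝ) : ℂ) • imageOfIdentity g) := by
  have hn' : (1 : ℝ) ≤ n := by exact_mod_cast hn
  have hm₀ : (0 : ℝ) < m := (Real.rpow_pos_of_pos (by linarith) _).trans_le hnm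
  have hln : (n : ℝ) ^ (1 / q) ≤ √n := by
    rw [Real.sqrt_eq_rpow]
    exact Real.rpow_le_rpow_of_exponent_le hn' (one_div_le_one_div_of_le two_pos hq)
  exact ⟨rank_smul_imageOfIdentity (Complex.ofReal_ne_zero.2 (by positivity)) hdet,
    hg.epsNorm_le hS (by linarith) (by linarith) hn hnm (by positivity),
    hg.rpow_le_minNorm hS hB (by positivity) hln q hn (by exact_mod_cast hm₀)⟩

theorem gaussianMatrix_isTypical_and_det_ne_zero_pos {K : ℝ} (hn : 1 ≤ n) (hnm : n ≤ m)
    (hcard : S.card ≤ 5 ^ n) (hS : (S : Set (EuclideanSpace ℝ (Fin n))) ⊆ sphere 0 1) (hl : 0 ≤ l)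
    (hK : m * Real.exp (-(l ^ 2 / 4)) ≤ K) (e : Fin n ↪ Fin m) :
    0 < gaussianMatrix n m {g | IsTypical S l (2 * K + 4) (toMatrix g) ∧
      ((toMatrix g).submatrix id e).det ≠ 0} :=
  gaussianMatrix_pos_of_isOpen
    ((isOpen_setOf_isTypical S l _).inter (isOpen_setOf_det_submatrix_ne_zero e))
    ((dense_setOf_det_submatrix_ne_zero e).inter_open_nonempty _ (isOpen_setOf_isTypical S l _)
      (exists_isTypical hn hnm hcard hS hl hK))

end Typical

end OpSpace

theorem mainTheorem5 (q : ℝ) (hq : 2 < q) :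
    ∃ D κ : ℝ, 0 < D ∧ 0 < κ ∧ ∀ n m : ℕ, 1 ≤ n →
      (n : ℝ) ^ (q / 2) ≤ m → (m : ℝ) ≤ 2 * (n : ℝ) ^ (q / 2) →
      (∃ a : Matrix (Fin m) (Fin m) ℂ, OpSpace.Separates q D n m a) ∧
      0 < OpSpace.gaussianMatrix n m
        {g | OpSpace.Separates q D n m
          (((κ * (m : ℝ) ^ (-2 / q) : ℝ) : ℂ) • OpSpace.imageOfIdentity g)} := by
  set B : ℝ := 2 * (2 * (q ^ 2) ^ (q ^ 2 / 4)) + 4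
  have hB₄ : 4 ≤ B := le_add_of_nonneg_left (by positivity)
  set κ : ℝ := (5000 * (3 * (1 + 2 * √B))) ^ 2
  refine ⟨κ * (8 * (1 + 2 * √B) ^ 2), κ, by positivity, by positivity, fun n m hn hnm hmn => ?_⟩
  have hle : n ≤ m := by
    have hself := Real.self_le_rpow_of_one_le (Nat.one_le_cast.2 hn : (1 : ℝ) ≤ n)
      (by linarith : 1 ≤ q / 2)
    exact_mod_cast hself.trans hnm
  obtain ⟨S, hcard, hsphere, hcover⟩ := OpSpace.exists_finset_isCover_card_le
    (Metric.sphere_subset_closedBall (x := (0 : EuclideanSpace ℝ (Fin n))) (ε := 1))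
  rw [finrank_euclideanSpace_fin] at hcard
  have htypical := OpSpace.gaussianMatrix_isTypical_and_det_ne_zero_pos hn hle hcard hsphere
    (by positivity : 0 ≤ (n : ℝ) ^ (1 / q))
    (OpSpace.mul_exp_neg_sq_rpow_le (by linarith) (Nat.cast_nonneg n) hmn) (Fin.castLEEmb hle)
  have hpos := htypical.trans_le <| measure_mono fun g hg =>
    hg.1.separates hcover hB₄ hq.le hn hnm hg.2
  obtain ⟨g, hg⟩ := nonempty_of_measure_ne_zero hpos.ne'
  exact ⟨⟨_, hg⟩, hpos⟩
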